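/- Let $T:\mathbb{R}^2\to\mathbb{R}^2$ be an invertible linear map with inverse $T^{-1}=\begin{pmatrix} a & b\\ c& d\end{pmatrix}$, where $ab\neq 0$. For $\mu,\nu\in\mathcal{S}'(\mathbb{R})$ let $$W_T(\mu,\nu)=\mathcal{F}_2\big((\mu\otimes\overline{\nu})\circ T\big)\in\mathcal{S}'(\mathbb{R}^2)$$ be their matrix-Wigner transform, where $\mathcal{F}_2$ is the partial Fourier transform in the second variable, $\mathcal{F}_2F(x,\omega)=\int_{\mathbb{R}}F(x,t)e^{-2\pi i\omega t}\,dt$, extended to $\mathcal{S}'(\mathbb{R}^2)$. A set $A\subset\mathbb{R}$ is called uniformly discrete if there is $\delta>0$ such that $|r-s|\ge\delta$ for all $r,s\in A$ with $r\neq s$. Let $\mu,\nu\in\mathcal{S}'(\mathbb{R})\setminus\{0\}$, and suppose that there are uniformly discrete sets $A,B\subset\mathbb{R}$ and complex numbers $c_{r,s}$ such that $$W_T(\mu,\nu)=\sum_{(r,s)\in A\times B}c_{r,s}\,\delta_{(r,s)}$$ in $\mathcal{S}'(\mathbb{R}^2)$. Then the Fourier transforms $\widehat{\mu}$ and $\widehat{\nu}$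 are (complex Radon) measures supported in uniformly discrete subsets of $\mathbb{R}$. -/

import Mathlib

open SchwartzMap TemperedDistribution MeasureTheory
open scoped FourierTransform LineDeriv ComplexConjugate

namespace MatrixWigner

/-- A set of real numbers is uniformly discrete if distinct points have a distance bounded below
by some positive constant. -/
def UniformlyDiscrete (A : Set ℝ) : Prop :=
  ∃ δ : ℝ, 0 < δ ∧ ∀ r ∈ A, ∀ s ∈ A, r ≠ s → δ ≤ |r - s|

/-- A tempered distribution on the line is a measure if on compactly supported test functions it is
integration against a complex Radon measure, written in polar form `h dm` with `m` a positive
locally finite Borel measure and `h` a measurable function of modulus one. -/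
def IsMeasure (u : 𝓢'(ℝ, ℂ)) : Prop :=
  ∃ (m : Measure ℝ) (h : ℝ → ℂ), IsLocallyFiniteMeasure m ∧ Measurable h ∧ (∀ x, ‖h x‖ = 1) ∧
    ∀ φ : 𝓢(ℝ, ℂ), HasCompactSupport φ → u φ = ∫ x, φ x * h x ∂m

/-! ### A criterion for a family of functions to be Schwartz -/

section Criterion

variable {D F ι : Type*} [NormedAddCommGroup D] [NormedSpace ℝ D]
  [NormedAddCommGroup F] [NormedSpace ℝ F] [Fintype ι]

theorem bound_of_continuous_seminorm (p : Seminorm ℂ 𝓢(D, ℂ)) (hp : Continuous p) :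
    ∃ (s : Finset (ℕ × ℕ)) (C : ℝ), 0 ≤ C ∧ ∀ φ : 𝓢(D, ℂ),
      p φ ≤ C * s.sup (schwartzSeminormFamily ℂ D ℂ) φ := by
  obtain ⟨s, C, -, h⟩ := Seminorm.bound_of_continuous (schwartz_withSeminorms ℂ D ℂ) p hp
  exact ⟨s, C, C.2, fun φ => h φ⟩

theorem contDiff_nat_of_family (A : 𝓢(D, ℂ) → F → ℂ) (P : ι → 𝓢(D, ℂ) →L[ℂ] 𝓢(D, ℂ))
    (e : ι → F →L[ℝ] ℝ)
    (hA : ∀ φ x, HasFDerivAt (A φ) (∑ i, (e i).smulRight (A (P i φ) x)) x) (n : ℕ) :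
    ∀ φ, ContDiff ℝ n (A φ) := by
  induction n with
  | zero =>
    intro φ
    exact contDiff_zero.2 (continuous_iff_continuousAt.2 fun x => (hA φ x).continuousAt)
  | succ n ih =>
    intro φ
    rw [show ((n + 1 : ℕ) : WithTop ℕ∞) = (n : WithTop ℕ∞) + 1 by push_cast; rfl,
      contDiff_succ_iff_hasFDerivAt]
    refine ⟨_, ?_, hA φ⟩
    exact ContDiff.sum fun i _ =>
      (ContinuousLinearMap.smulRightL ℝ F ℂ (e i)).contDiff.comp (ih (P i φ))

theorem decay_of_family (A : 𝓢(D, ℂ) → F → ℂ) (P : ι → 𝓢(D, ℂ) →L[ℂ] 𝓢(D, ℂ))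
    (e : ι → F →L[ℝ] ℝ)
    (hA : ∀ φ x, HasFDerivAt (A φ) (∑ i, (e i).smulRight (A (P i φ) x)) x)
    (hdecay : ∀ k : ℕ, ∃ p : Seminorm ℂ 𝓢(D, ℂ), Continuous p ∧ ∀ φ x, ‖x‖ ^ k * ‖A φ x‖ ≤ p φ)
    (k n : ℕ) :
    ∃ p : Seminorm ℂ 𝓢(D, ℂ), Continuous p ∧
      ∀ φ x, ‖x‖ ^ k * ‖iteratedFDeriv ℝ n (A φ) x‖ ≤ p φ := by
  induction n with
  | zero => simpa using hdecay k
  | succ n ih =>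
    obtain ⟨p, hp, hb⟩ := ih
    have hfun : (⇑(∑ i, ‖e i‖₊ • p.comp (P i).toLinearMap) : 𝓢(D, ℂ) → ℝ) =
        fun φ => ∑ i, ‖e i‖ * p (P i φ) := by
      ext φ
      simp [NNReal.smul_def]
    refine ⟨∑ i, ‖e i‖₊ • p.comp (P i).toLinearMap, ?_, fun φ x => ?_⟩
    · rw [hfun]
      exact continuous_finsetSum _ fun i _ => continuous_const.mul (hp.comp (P i).continuous)
    · have hfd : fderiv ℝ (A φ) =
          fun x => ∑ i, ContinuousLinearMap.smulRightL ℝ F ℂ (e i) (A (P i φ) x) :=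
        funext fun x => (hA φ x).fderiv
      have hc : ∀ i, ContDiffAt ℝ n (A (P i φ)) x := fun i =>
        (contDiff_nat_of_family A P e hA n (P i φ)).contDiffAt
      rw [← norm_iteratedFDeriv_fderiv, hfd, iteratedFDeriv_fun_sum_apply, hfun]
      · calc ‖x‖ ^ k * ‖∑ i, iteratedFDeriv ℝ n
              (fun x => ContinuousLinearMap.smulRightL ℝ F ℂ (e i) (A (P i φ) x)) x‖
            ≤ ‖x‖ ^ k * ∑ i, ‖e i‖ * ‖iteratedFDeriv ℝ n (A (P i φ)) x‖ := by
              gcongr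
              refine (norm_sum_le _ _).trans (Finset.sum_le_sum fun i _ => ?_)
              refine (ContinuousLinearMap.norm_iteratedFDeriv_comp_left
                (ContinuousLinearMap.smulRightL ℝ F ℂ (e i)) (hc i) le_rfl).trans ?_
              gcongr
              refine ContinuousLinearMap.opNorm_le_bound _ (norm_nonneg _) fun z => ?_
              simp
          _ = ∑ i, ‖e i‖ * (‖x‖ ^ k * ‖iteratedFDeriv ℝ n (A (P i φ)) x‖) := by
              rw [Finset.mul_sum]
              exact Finset.sum_congr rfl fun i _ => by ring
          _ ≤ ∑ i, ‖e i‖ * p (P i φ) := by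
              gcongr with i
              exact hb _ _
      · exact fun i _ => (ContinuousLinearMap.smulRightL ℝ F ℂ (e i)).contDiff.contDiffAt.comp x
          (hc i)

/-- A family `A` of functions, depending linearly on a Schwartz function, whose derivatives are
given by `A` itself and which decays rapidly, is a continuous linear map to Schwartz functions. -/
noncomputable def mkFamily (A : 𝓢(D, ℂ) → F → ℂ)
    (hadd : ∀ φ ψ x, A (φ + ψ) x = A φ x + A ψ x) (hsmul : ∀ (a : ℂ) φ x, A (a • φ) x = a * A φ x)
    (P : ι → 𝓢(D, ℂ) →L[ℂ] 𝓢(D, ℂ)) (e : ι → F →L[ℝ] ℝ)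
    (hA : ∀ φ x, HasFDerivAt (A φ) (∑ i, (e i).smulRight (A (P i φ) x)) x)
    (hdecay : ∀ k : ℕ, ∃ p : Seminorm ℂ 𝓢(D, ℂ), Continuous p ∧ ∀ φ x, ‖x‖ ^ k * ‖A φ x‖ ≤ p φ) :
    𝓢(D, ℂ) →L[ℂ] 𝓢(F, ℂ) :=
  SchwartzMap.mkCLM A hadd hsmul
    (fun φ => contDiff_infty.2 fun n => contDiff_nat_of_family A P e hA n φ) fun kn => by
      obtain ⟨p, hp, hb⟩ := decay_of_family A P e hA hdecay kn.1 kn.2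
      obtain ⟨s, C, hC, h⟩ := bound_of_continuous_seminorm p hp
      exact ⟨s, C, hC, fun φ x => (hb φ x).trans (h φ)⟩

end Criterion

/-! ### Slices and partial derivatives -/

/-- The function `y ↦ φ (x, y)` for a Schwartz function `φ` of two variables. -/
noncomputable def slice (x : ℝ) : 𝓢(ℝ × ℝ, ℂ) →L[ℂ] 𝓢(ℝ, ℂ) :=
  SchwartzMap.compCLMOfAntilipschitz (K := 1) (g := fun y : ℝ => (x, y)) ℂ
    (by
      have : (fun y : ℝ => ((x, y) : ℝ × ℝ)) =
          fun y => ContinuousLinearMap.inr ℝ ℝ ℝ y + ((x, 0) : ℝ × ℝ) := by ext y <;> simp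
      rw [this]
      exact (ContinuousLinearMap.inr ℝ ℝ ℝ).hasTemperateGrowth.add
        (Function.HasTemperateGrowth.const _)) (fun y z => by simp [Prod.edist_eq])

@[simp]
theorem slice_apply (x : ℝ) (φ : 𝓢(ℝ × ℝ, ℂ)) (y : ℝ) : slice x φ y = φ (x, y) := rfl

/-- The partial derivative in the first variable. -/
noncomputable def d₁ : 𝓢(ℝ × ℝ, ℂ) →L[ℂ] 𝓢(ℝ × ℝ, ℂ) :=
  LineDeriv.lineDerivOpCLM ℂ 𝓢(ℝ × ℝ, ℂ) ((1, 0) : ℝ × ℝ)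

/-- The partial derivative in the second variable. -/
noncomputable def d₂ : 𝓢(ℝ × ℝ, ℂ) →L[ℂ] 𝓢(ℝ × ℝ, ℂ) :=
  LineDeriv.lineDerivOpCLM ℂ 𝓢(ℝ × ℝ, ℂ) ((0, 1) : ℝ × ℝ)

theorem hasDerivAt_fst (φ : 𝓢(ℝ × ℝ, ℂ)) (x y : ℝ) :
    HasDerivAt (fun s => φ (s, y)) (d₁ φ (x, y)) x := by
  have h := (φ.hasFDerivAt (x, y)).comp_hasDerivAt x
    ((hasDerivAt_id x).prodMk (hasDerivAt_const x y))
  exact h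

theorem hasDerivAt_snd (φ : 𝓢(ℝ × ℝ, ℂ)) (x y : ℝ) :
    HasDerivAt (fun s => φ (x, s)) (d₂ φ (x, y)) y := by
  have h := (φ.hasFDerivAt (x, y)).comp_hasDerivAt y
    ((hasDerivAt_const y x).prodMk (hasDerivAt_id y))
  exact h

theorem d₁_d₂ (φ : 𝓢(ℝ × ℝ, ℂ)) : d₁ (d₂ φ) = d₂ (d₁ φ) := by
  ext z
  have hd : DifferentiableAt ℝ (fderiv ℝ φ) z :=
    (((φ.smooth 2).fderiv_right (m := 1) (by norm_num)).differentiable (by norm_num)) z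
  have hs : IsSymmSndFDerivAt ℝ φ z :=
    ((φ.smooth 2).contDiffAt).isSymmSndFDerivAt (by simp)
  have key : ∀ v w : ℝ × ℝ, fderiv ℝ (fun y => fderiv ℝ φ y w) z v =
      fderiv ℝ (fderiv ℝ φ) z v w := by
    intro v w
    have := (hd.hasFDerivAt.clm_apply (hasFDerivAt_const w z)).fderiv
    rw [this]
    simp
  change fderiv ℝ (fun y => fderiv ℝ φ y (0, 1)) z (1, 0) =
    fderiv ℝ (fun y => fderiv ℝ φ y (1, 0)) z (0, 1)
  rw [key, key]
  exact hs _ _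

/-- Iterated partial derivative in the second variable. -/
noncomputable def d₂iter : ℕ → 𝓢(ℝ × ℝ, ℂ) →L[ℂ] 𝓢(ℝ × ℝ, ℂ)
  | 0 => ContinuousLinearMap.id ℂ _
  | n + 1 => (d₂iter n).comp d₂

theorem d₁_d₂iter (n : ℕ) (φ : 𝓢(ℝ × ℝ, ℂ)) : d₁ (d₂iter n φ) = d₂iter n (d₁ φ) := by
  induction n generalizing φ with
  | zero => rfl
  | succ n ih =>
    change d₁ (d₂iter n (d₂ φ)) = d₂iter n (d₂ (d₁ φ))
    rw [ih, d₁_d₂]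

theorem iteratedDeriv_slice (n : ℕ) (φ : 𝓢(ℝ × ℝ, ℂ)) (x y : ℝ) :
    iteratedDeriv n (slice x φ) y = d₂iter n φ (x, y) := by
  induction n generalizing φ with
  | zero => simp [d₂iter]
  | succ n ih =>
    rw [iteratedDeriv_succ']
    have : deriv (slice x φ) = slice x (d₂ φ) := by
      ext s
      exact (hasDerivAt_snd φ x s).deriv
    rw [this, ih]
    rfl

theorem abs_pow_mul_le (φ : 𝓢(ℝ × ℝ, ℂ)) (j k : ℕ) (x y : ℝ) :
    |x| ^ j * (|y| ^ k * ‖φ (x, y)‖) ≤ SchwartzMap.seminorm ℂ (j + k) 0 φ := by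
  refine le_trans ?_ (SchwartzMap.norm_pow_mul_le_seminorm ℂ φ (j + k) (x, y))
  rw [← mul_assoc, pow_add]
  gcongr
  · exact norm_fst_le (x, y)
  · exact norm_snd_le (x, y)

theorem seminorm_slice_le (j k n : ℕ) (φ : 𝓢(ℝ × ℝ, ℂ)) (x : ℝ) :
    |x| ^ j * SchwartzMap.seminorm ℂ k n (slice x φ) ≤
      SchwartzMap.seminorm ℂ (j + k) 0 (d₂iter n φ) := by
  rcases eq_or_ne (|x| ^ j) 0 with h0 | h0
  · rw [h0, zero_mul]
    exact apply_nonneg _ _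
  · have hpos : 0 < |x| ^ j := lt_of_le_of_ne (by positivity) (Ne.symm h0)
    rw [← le_div_iff₀' hpos]
    refine SchwartzMap.seminorm_le_bound' ℂ k n _ (by positivity) fun y => ?_
    rw [le_div_iff₀' hpos, iteratedDeriv_slice]
    exact abs_pow_mul_le _ _ _ _ _

/-- A first order Taylor estimate in the Schwartz seminorms for the slices. -/
theorem seminorm_slice_taylor (k n : ℕ) (φ : 𝓢(ℝ × ℝ, ℂ)) (x h : ℝ) :
    SchwartzMap.seminorm ℂ k n (slice (x + h) φ - slice x φ - (h : ℂ) • slice x (d₁ φ)) ≤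
      SchwartzMap.seminorm ℂ k 0 (d₁ (d₁ (d₂iter n φ))) * h ^ 2 := by
  set ψ := d₂iter n φ with hψ
  set M := SchwartzMap.seminorm ℂ k 0 (d₁ (d₁ ψ)) with hM
  refine SchwartzMap.seminorm_le_bound' ℂ k n _ (by positivity) fun y => ?_
  have e1 : slice (x + h) φ - slice x φ - (h : ℂ) • slice x (d₁ φ) =
      slice (x + h) φ - slice x φ - slice x ((h : ℂ) • d₁ φ) := by simp
  have e2 : iteratedDeriv n (slice (x + h) φ - slice x φ - (h : ℂ) • slice x (d₁ φ) : 𝓢(ℝ, ℂ)) y =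
      ψ (x + h, y) - ψ (x, y) - h * d₁ ψ (x, y) := by
    have c : ∀ f : 𝓢(ℝ, ℂ), ContDiffAt ℝ n f y := fun f => (f.smooth n).contDiffAt
    have s1 : ∀ f g : 𝓢(ℝ, ℂ), iteratedDeriv n (f - g : 𝓢(ℝ, ℂ)) y =
        iteratedDeriv n f y - iteratedDeriv n g y := fun f g =>
      iteratedDeriv_sub (c f) (c g)
    rw [e1, s1, s1, iteratedDeriv_slice, iteratedDeriv_slice, iteratedDeriv_slice, map_smul,
      ← d₁_d₂iter]
    simp [hψ]
  rw [e2]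
  -- weighted one-variable function
  set f : ℝ → ℂ := fun s => ψ (s, y) with hf
  set f' : ℝ → ℂ := fun s => d₁ ψ (s, y) with hf'
  set f'' : ℝ → ℂ := fun s => d₁ (d₁ ψ) (s, y) with hf''
  have hb2 : ∀ s, |y| ^ k * ‖f'' s‖ ≤ M := fun s => by
    have := abs_pow_mul_le (d₁ (d₁ ψ)) 0 k s y
    simpa using this
  have hb1 : ∀ s, |y| ^ k * ‖f' s - f' x‖ ≤ M * |s - x| := fun s => by
    have := Convex.norm_image_sub_le_of_norm_hasDerivWithin_le (s := Set.univ)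
      (f := fun s => ((|y| ^ k : ℝ) : ℂ) * f' s) (f' := fun s => ((|y| ^ k : ℝ) : ℂ) * f'' s)
      (C := M) (x := x) (y := s)
      (fun t _ => ((hasDerivAt_fst (d₁ ψ) t y).const_mul _).hasDerivWithinAt)
      (fun t _ => by simpa using hb2 t) convex_univ trivial trivial
    rw [← mul_sub] at this
    simpa using this
  have := Convex.norm_image_sub_le_of_norm_hasDerivWithin_le (s := Set.uIcc x (x + h))
      (f := fun s => ((|y| ^ k : ℝ) : ℂ) * (f s - s * f' x))
      (f' := fun s => ((|y| ^ k : ℝ) : ℂ) * (f' s - 1 * f' x))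
      (C := M * |h|) (x := x) (y := x + h)
      (fun t _ => (((hasDerivAt_fst ψ t y).sub
        ((Complex.ofRealCLM.hasDerivAt (x := t)).mul_const (f' x))).const_mul _).hasDerivWithinAt)
      (fun t ht => by
        have h1 := hb1 t
        have h2 : |t - x| ≤ |h| := by
          have := Set.abs_sub_left_of_mem_uIcc ht
          simpa [abs_sub_comm] using this
        have hM0 : 0 ≤ M := apply_nonneg _ _
        have := h1.trans (mul_le_mul_of_nonneg_left h2 hM0)
        simpa using this) (convex_uIcc _ _) Set.left_mem_uIcc Set.right_mem_uIcc
  rw [← mul_sub] at this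
  have e3 : f (x + h) - ((x + h : ℝ) : ℂ) * f' x - (f x - x * f' x) =
      f (x + h) - f x - h * f' x := by push_cast; ring
  rw [e3] at this
  have h4 : M * |h| * |h| = M * h ^ 2 := by rw [mul_assoc, ← pow_two, sq_abs]
  simpa [h4] using this

/-! ### Application of a distribution in the second variable -/

theorem exists_bound (ν : 𝓢'(ℝ, ℂ)) :
    ∃ (s : Finset (ℕ × ℕ)) (C : ℝ), 0 ≤ C ∧ ∀ ψ : 𝓢(ℝ, ℂ),
      ‖ν ψ‖ ≤ C * ∑ i ∈ s, SchwartzMap.seminorm ℂ i.1 i.2 ψ := by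
  obtain ⟨s, C, hC, h⟩ := bound_of_continuous_seminorm
    ((normSeminorm ℂ ℂ).comp (ν : 𝓢(ℝ, ℂ) →L[ℂ] ℂ).toLinearMap)
    (continuous_norm.comp (ν : 𝓢(ℝ, ℂ) →L[ℂ] ℂ).continuous)
  refine ⟨s, C, hC, fun ψ => (h ψ).trans ?_⟩
  refine mul_le_mul_of_nonneg_left ?_ hC
  exact (Seminorm.finset_sup_le_sum (schwartzSeminormFamily ℂ ℝ ℂ) s ψ).trans_eq (by simp; rfl)

theorem hasDerivAt_apply_slice (ν : 𝓢'(ℝ, ℂ)) (φ : 𝓢(ℝ × ℝ, ℂ)) (x : ℝ) :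
    HasDerivAt (fun s => ν (slice s φ)) (ν (slice x (d₁ φ))) x := by
  obtain ⟨s, C, hC, hb⟩ := exists_bound ν
  rw [hasDerivAt_iff_isLittleO_nhds_zero]
  set K : ℝ := C * ∑ i ∈ s, SchwartzMap.seminorm ℂ i.1 0 (d₁ (d₁ (d₂iter i.2 φ))) with hK
  have hO : (fun h : ℝ => ν (slice (x + h) φ) - ν (slice x φ) - h • ν (slice x (d₁ φ)))
      =O[nhds 0] fun h : ℝ => h ^ 2 := by
    refine Asymptotics.IsBigO.of_bound K (Filter.Eventually.of_forall fun h => ?_)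
    have e : ν (slice (x + h) φ) - ν (slice x φ) - h • ν (slice x (d₁ φ)) =
        ν (slice (x + h) φ - slice x φ - (h : ℂ) • slice x (d₁ φ)) := by
      rw [map_sub, map_sub, map_smul, Complex.real_smul, smul_eq_mul]
    rw [e]
    refine (hb _).trans ?_
    rw [hK, mul_assoc, Finset.sum_mul]
    gcongr with i
    simpa using seminorm_slice_taylor i.1 i.2 φ x h
  refine hO.trans_isLittleO ?_
  simpa using Asymptotics.isLittleO_pow_id (𝕜 := ℝ) (n := 2) (by norm_num)

/-- The Schwartz function `x ↦ ν (φ (x, ·))`. -/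
noncomputable def applySnd (ν : 𝓢'(ℝ, ℂ)) : 𝓢(ℝ × ℝ, ℂ) →L[ℂ] 𝓢(ℝ, ℂ) :=
  mkFamily (ι := Unit) (fun φ x => ν (slice x φ)) (fun φ ψ x => by simp) (fun a φ x => by simp)
    (fun _ => d₁) (fun _ => ContinuousLinearMap.id ℝ ℝ)
    (fun φ x => by
      have h := (hasDerivAt_apply_slice ν φ x).hasFDerivAt
      have e : ∑ _i : Unit, (ContinuousLinearMap.id ℝ ℝ).smulRight (ν (slice x (d₁ φ))) =
          ContinuousLinearMap.toSpanSingleton ℝ (ν (slice x (d₁ φ))) := by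
        ext
        simp
      rw [e]
      exact h)
    (fun k => by
      obtain ⟨s, C, hC, hb⟩ := exists_bound ν
      have hfun : (⇑(∑ i ∈ s, C.toNNReal •
          (SchwartzMap.seminorm ℂ (k + i.1) 0).comp (d₂iter i.2).toLinearMap) :
            𝓢(ℝ × ℝ, ℂ) → ℝ) =
          fun φ => ∑ i ∈ s, C * SchwartzMap.seminorm ℂ (k + i.1) 0 (d₂iter i.2 φ) := by
        ext φ
        simp [NNReal.smul_def, hC]
      refine ⟨∑ i ∈ s, C.toNNReal •
          (SchwartzMap.seminorm ℂ (k + i.1) 0).comp (d₂iter i.2).toLinearMap, ?_, fun φ x => ?_⟩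
      · rw [hfun]
        exact continuous_finsetSum _ fun i _ => continuous_const.mul
          (((schwartz_withSeminorms ℂ (ℝ × ℝ) ℂ).continuous_seminorm (k + i.1, 0)).comp
            (d₂iter i.2).continuous)
      · rw [hfun]
        calc ‖x‖ ^ k * ‖ν (slice x φ)‖
            ≤ ‖x‖ ^ k * (C * ∑ i ∈ s, SchwartzMap.seminorm ℂ i.1 i.2 (slice x φ)) := by
              gcongr
              exact hb _
          _ = ∑ i ∈ s, C * (|x| ^ k * SchwartzMap.seminorm ℂ i.1 i.2 (slice x φ)) := by
              rw [Finset.mul_sum, Finset.mul_sum]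
              exact Finset.sum_congr rfl fun i _ => by rw [Real.norm_eq_abs]; ring
          _ ≤ _ := by
              exact Finset.sum_le_sum fun i _ =>
                mul_le_mul_of_nonneg_left (seminorm_slice_le _ _ _ _ _) hC)

@[simp]
theorem applySnd_apply (ν : 𝓢'(ℝ, ℂ)) (φ : 𝓢(ℝ × ℝ, ℂ)) (x : ℝ) :
    applySnd ν φ x = ν (slice x φ) := rfl

/-- The tensor product `μ ⊗ ν` of two tempered distributions on the line. -/
noncomputable def tensor (μ ν : 𝓢'(ℝ, ℂ)) : 𝓢'(ℝ × ℝ, ℂ) :=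
  PointwiseConvergenceCLM.precomp ℂ (applySnd ν) μ

theorem tensor_apply (μ ν : 𝓢'(ℝ, ℂ)) (φ : 𝓢(ℝ × ℝ, ℂ)) :
    tensor μ ν φ = μ (applySnd ν φ) := rfl

/-! ### Complex conjugation -/

/-- The complex conjugate of a Schwartz function. -/
noncomputable def conjSchwartz : 𝓢(ℝ, ℂ) →L[ℝ] 𝓢(ℝ, ℂ) :=
  SchwartzMap.postcompCLM (Complex.conjCLE : ℂ →L[ℝ] ℂ)

@[simp]
theorem conjSchwartz_apply (φ : 𝓢(ℝ, ℂ)) (x : ℝ) : conjSchwartz φ x = conj (φ x) := rfl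

/-- The complex conjugate of a tempered distribution, `φ ↦ conj (ν (conj φ))`. -/
noncomputable def conjDist (ν : 𝓢'(ℝ, ℂ)) : 𝓢'(ℝ, ℂ) :=
  ContinuousLinearMap.toPointwiseConvergenceCLM ℂ (RingHom.id ℂ) 𝓢(ℝ, ℂ) ℂ
    { toFun := fun φ => conj (ν (conjSchwartz φ))
      map_add' := fun φ ψ => by simp
      map_smul' := fun a φ => by
        have : conjSchwartz (a • φ) = conj a • conjSchwartz φ := by
          ext x
          simp
        rw [this]
        simp
      cont := Complex.continuous_conj.comp
        ((ν : 𝓢(ℝ, ℂ) →L[ℂ] ℂ).continuous.comp conjSchwartz.continuous) }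

@[simp]
theorem conjDist_apply (ν : 𝓢'(ℝ, ℂ)) (φ : 𝓢(ℝ, ℂ)) :
    conjDist ν φ = conj (ν (conjSchwartz φ)) := rfl

/-! ### Partial Fourier transform in the second variable -/

theorem snd_hasTemperateGrowth :
    Function.HasTemperateGrowth fun z : ℝ × ℝ => (-(2 * Real.pi * Complex.I) * (z.2 : ℂ) : ℂ) := by
  have h1 : Function.HasTemperateGrowth fun z : ℝ × ℝ => (z.2 : ℂ) :=
    (Complex.ofRealCLM.comp (ContinuousLinearMap.snd ℝ ℝ ℝ)).hasTemperateGrowth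
  exact (Function.HasTemperateGrowth.const _).mul h1

/-- Multiplication by `-2πi t`, where `t` is the second variable. -/
noncomputable def mulSnd : 𝓢(ℝ × ℝ, ℂ) →L[ℂ] 𝓢(ℝ × ℝ, ℂ) :=
  SchwartzMap.smulLeftCLM ℂ fun z : ℝ × ℝ => (-(2 * Real.pi * Complex.I) * (z.2 : ℂ) : ℂ)

theorem mulSnd_apply (φ : 𝓢(ℝ × ℝ, ℂ)) (x t : ℝ) :
    mulSnd φ (x, t) = -(2 * Real.pi * Complex.I) * t * φ (x, t) := by
  rw [mulSnd, SchwartzMap.smulLeftCLM_apply_apply snd_hasTemperateGrowth]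
  rfl

/-- The integral defining the partial Fourier transform in the second variable. -/
noncomputable def pf (φ : 𝓢(ℝ × ℝ, ℂ)) (z : ℝ × ℝ) : ℂ :=
  ∫ t : ℝ, φ (z.1, t) * Complex.exp (-(2 * Real.pi * Complex.I) * z.2 * t)

theorem norm_exp_eq (a t : ℝ) : ‖Complex.exp (-(2 * Real.pi * Complex.I) * a * t)‖ = 1 := by
  rw [Complex.norm_exp]
  simp

theorem bound_two (φ : 𝓢(ℝ × ℝ, ℂ)) (j : ℕ) (x t : ℝ) :
    |x| ^ j * ‖φ (x, t)‖ ≤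
      (SchwartzMap.seminorm ℂ j 0 φ + SchwartzMap.seminorm ℂ (j + 2) 0 φ) * (1 + t ^ 2)⁻¹ := by
  have h0 := abs_pow_mul_le φ j 0 x t
  have h2 := abs_pow_mul_le φ j 2 x t
  rw [← div_eq_mul_inv, le_div_iff₀ (by positivity)]
  simp only [pow_zero, one_mul, add_zero, sq_abs] at h0 h2
  linarith

theorem integrable_pf (φ : 𝓢(ℝ × ℝ, ℂ)) (z : ℝ × ℝ) :
    Integrable fun t : ℝ => φ (z.1, t) * Complex.exp (-(2 * Real.pi * Complex.I) * z.2 * t) := by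
  refine ((slice z.1 φ).integrable (μ := volume)).mul_bdd (c := 1)
    (by fun_prop) (Filter.Eventually.of_forall fun t => (norm_exp_eq z.2 t).le)

theorem pow_mul_norm_pf_le (φ : 𝓢(ℝ × ℝ, ℂ)) (j : ℕ) (z : ℝ × ℝ) :
    |z.1| ^ j * ‖pf φ z‖ ≤
      (SchwartzMap.seminorm ℂ j 0 φ + SchwartzMap.seminorm ℂ (j + 2) 0 φ) * Real.pi := by
  rw [← integral_univ_inv_one_add_sq, ← integral_const_mul]
  have : |z.1| ^ j * ‖pf φ z‖ = ‖∫ t : ℝ, ((|z.1| ^ j : ℝ) : ℂ) *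
      (φ (z.1, t) * Complex.exp (-(2 * Real.pi * Complex.I) * z.2 * t))‖ := by
    rw [integral_const_mul, norm_mul, pf]
    simp
  rw [this]
  refine norm_integral_le_of_norm_le (integrable_inv_one_add_sq.const_mul _)
    (Filter.Eventually.of_forall fun t => ?_)
  rw [norm_mul, norm_mul, norm_exp_eq, mul_one]
  simpa using bound_two φ j z.1 t

theorem pf_eq_fourier (φ : 𝓢(ℝ × ℝ, ℂ)) (z : ℝ × ℝ) : pf φ z = 𝓕 (slice z.1 φ : ℝ → ℂ) z.2 := by
  rw [Real.fourier_real_eq_integral_exp_smul, pf]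
  congr 1
  ext t
  rw [smul_eq_mul, mul_comm, slice_apply]
  congr 2
  push_cast
  ring

theorem pf_d₂ (φ : 𝓢(ℝ × ℝ, ℂ)) (z : ℝ × ℝ) :
    pf (d₂ φ) z = (2 * Real.pi * Complex.I * z.2) * pf φ z := by
  have hd : (slice z.1 (d₂ φ) : ℝ → ℂ) = deriv (slice z.1 φ) := by
    ext s
    exact (hasDerivAt_snd φ z.1 s).deriv.symm
  rw [pf_eq_fourier, hd, Real.fourier_deriv (slice z.1 φ).integrable (slice z.1 φ).differentiable
    (by rw [← hd]; exact (slice z.1 (d₂ φ)).integrable), pf_eq_fourier]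
  rfl

theorem norm_pf_d₂ (φ : 𝓢(ℝ × ℝ, ℂ)) (z : ℝ × ℝ) :
    |z.2| * ‖pf φ z‖ ≤ ‖pf (d₂ φ) z‖ := by
  rw [pf_d₂, norm_mul]
  gcongr
  simp only [norm_mul, Complex.norm_ofNat, Complex.norm_real, Complex.norm_I, mul_one,
    Real.norm_eq_abs, abs_of_pos Real.pi_pos]
  have := Real.pi_gt_three
  nlinarith [abs_nonneg z.2]

theorem pow_norm_pf_d₂ (k : ℕ) (φ : 𝓢(ℝ × ℝ, ℂ)) (z : ℝ × ℝ) :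
    |z.2| ^ k * ‖pf φ z‖ ≤ ‖pf (d₂iter k φ) z‖ := by
  induction k generalizing φ with
  | zero => simp [d₂iter]
  | succ k ih =>
    calc |z.2| ^ (k + 1) * ‖pf φ z‖ = |z.2| ^ k * (|z.2| * ‖pf φ z‖) := by ring
      _ ≤ |z.2| ^ k * ‖pf (d₂ φ) z‖ := by gcongr; exact norm_pf_d₂ φ z
      _ ≤ _ := ih _

theorem hasFDerivAt_pf (φ : 𝓢(ℝ × ℝ, ℂ)) (z : ℝ × ℝ) :
    HasFDerivAt (pf φ) ((ContinuousLinearMap.fst ℝ ℝ ℝ).smulRight (pf (d₁ φ) z) +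
      (ContinuousLinearMap.snd ℝ ℝ ℝ).smulRight (pf (mulSnd φ) z)) z := by
  set E : ℝ × ℝ → ℝ → ℂ := fun w t => Complex.exp (-(2 * Real.pi * Complex.I) * w.2 * t) with hE
  set F' : ℝ × ℝ → ℝ → (ℝ × ℝ →L[ℝ] ℂ) := fun w t =>
    (ContinuousLinearMap.fst ℝ ℝ ℝ).smulRight (d₁ φ (w.1, t) * E w t) +
      (ContinuousLinearMap.snd ℝ ℝ ℝ).smulRight (mulSnd φ (w.1, t) * E w t) with hF'
  set b : 𝓢(ℝ × ℝ, ℂ) → ℝ := fun ψ =>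
    SchwartzMap.seminorm ℂ 0 0 ψ + SchwartzMap.seminorm ℂ 2 0 ψ with hb
  have hi1 := integrable_pf (d₁ φ) z
  have hi2 := integrable_pf (mulSnd φ) z
  have hL1 : Integrable fun t => (ContinuousLinearMap.fst ℝ ℝ ℝ).smulRight (d₁ φ (z.1, t) * E z t) :=
    (ContinuousLinearMap.smulRightL ℝ (ℝ × ℝ) ℂ (ContinuousLinearMap.fst ℝ ℝ ℝ)).integrable_comp hi1
  have hL2 : Integrable fun t =>
      (ContinuousLinearMap.snd ℝ ℝ ℝ).smulRight (mulSnd φ (z.1, t) * E z t) :=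
    (ContinuousLinearMap.smulRightL ℝ (ℝ × ℝ) ℂ (ContinuousLinearMap.snd ℝ ℝ ℝ)).integrable_comp hi2
  have hint : ∫ t, F' z t = (ContinuousLinearMap.fst ℝ ℝ ℝ).smulRight (pf (d₁ φ) z) +
      (ContinuousLinearMap.snd ℝ ℝ ℝ).smulRight (pf (mulSnd φ) z) := by
    rw [integral_add hL1 hL2]
    congr 1
    · exact (ContinuousLinearMap.smulRightL ℝ (ℝ × ℝ) ℂ
        (ContinuousLinearMap.fst ℝ ℝ ℝ)).integral_comp_comm hi1
    · exact (ContinuousLinearMap.smulRightL ℝ (ℝ × ℝ) ℂ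
        (ContinuousLinearMap.snd ℝ ℝ ℝ)).integral_comp_comm hi2
  rw [← hint]
  refine hasFDerivAt_integral_of_dominated_of_fderiv_le (𝕜 := ℝ) (s := Set.univ)
    (F := fun w t => φ (w.1, t) * E w t) (F' := F')
    (bound := fun t => (b (d₁ φ) + b (mulSnd φ)) * (1 + t ^ 2)⁻¹) Filter.univ_mem
    (Filter.Eventually.of_forall fun w => (integrable_pf φ w).aestronglyMeasurable)
    (integrable_pf φ z) (hL1.aestronglyMeasurable.add hL2.aestronglyMeasurable)
    (Filter.Eventually.of_forall fun t w _ => ?_)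
    (integrable_inv_one_add_sq.const_mul _)
    (Filter.Eventually.of_forall fun t w _ => ?_)
  · have h1 := bound_two (d₁ φ) 0 w.1 t
    have h2 := bound_two (mulSnd φ) 0 w.1 t
    simp only [pow_zero, one_mul, zero_add] at h1 h2
    rw [add_mul]
    refine (norm_add_le _ _).trans (add_le_add ?_ ?_)
    · rw [ContinuousLinearMap.norm_smulRight_apply, norm_mul, norm_exp_eq, mul_one]
      refine (mul_le_of_le_one_left (norm_nonneg _) (ContinuousLinearMap.norm_fst_le ..)).trans h1
    · rw [ContinuousLinearMap.norm_smulRight_apply, norm_mul, norm_exp_eq, mul_one]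
      refine (mul_le_of_le_one_left (norm_nonneg _) (ContinuousLinearMap.norm_snd_le ..)).trans h2
  · have h1 : HasFDerivAt (fun w : ℝ × ℝ => φ (w.1, t))
        ((ContinuousLinearMap.fst ℝ ℝ ℝ).smulRight (d₁ φ (w.1, t))) w := by
      refine HasFDerivAt.congr_fderiv ((hasDerivAt_fst φ w.1 t).hasFDerivAt.comp w
        (ContinuousLinearMap.fst ℝ ℝ ℝ).hasFDerivAt) ?_
      ext <;> simp
    have h2 : HasFDerivAt (fun w : ℝ × ℝ => E w t)
        ((ContinuousLinearMap.snd ℝ ℝ ℝ).smulRight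
          (E w t * (-(2 * Real.pi * Complex.I) * t))) w := by
      have h3 : HasDerivAt (fun a : ℝ => Complex.exp (-(2 * Real.pi * Complex.I) * a * t))
          (E w t * (-(2 * Real.pi * Complex.I) * t)) w.2 := by
        have := (((Complex.ofRealCLM.hasDerivAt (x := w.2)).const_mul
          (-(2 * Real.pi * Complex.I))).mul_const (t : ℂ)).cexp
        simpa [hE] using this
      refine HasFDerivAt.congr_fderiv
        (h3.hasFDerivAt.comp w (ContinuousLinearMap.snd ℝ ℝ ℝ).hasFDerivAt) ?_
      ext <;> simp
    refine HasFDerivAt.congr_fderiv (h1.mul h2) ?_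
    ext
    · simp [hF', mul_comm]
    · simp [hF', mulSnd_apply]
      ring

/-- The partial Fourier transform in the second variable on Schwartz functions of two variables,
`(x, ω) ↦ ∫ φ (x, t) exp (-2πiωt) dt`. -/
noncomputable def partialFourier : 𝓢(ℝ × ℝ, ℂ) →L[ℂ] 𝓢(ℝ × ℝ, ℂ) :=
  mkFamily (ι := Bool) pf
    (fun φ ψ z => by
      simp only [pf]
      rw [← integral_add (integrable_pf φ z) (integrable_pf ψ z)]
      simp [add_mul])
    (fun a φ z => by
      simp only [pf]
      rw [← integral_const_mul]
      simp [mul_assoc])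
    (fun i => if i then d₁ else mulSnd)
    (fun i => if i then ContinuousLinearMap.fst ℝ ℝ ℝ else ContinuousLinearMap.snd ℝ ℝ ℝ)
    (fun φ z => by simpa using hasFDerivAt_pf φ z)
    (fun k => by
      set q : ℕ → Seminorm ℂ 𝓢(ℝ × ℝ, ℂ) := fun k => SchwartzMap.seminorm ℂ k 0 with hq
      have hqc : ∀ k, Continuous (q k) := fun k =>
        (schwartz_withSeminorms ℂ (ℝ × ℝ) ℂ).continuous_seminorm (k, 0)
      refine ⟨Real.pi.toNNReal • (q k + q (k + 2) + (q 0 + q 2).comp (d₂iter k).toLinearMap),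
        ?_, fun φ z => ?_⟩
      · exact continuous_const.mul (((hqc k).add (hqc (k + 2))).add
          (((hqc 0).add (hqc 2)).comp (d₂iter k).continuous))
      · have h1 := pow_mul_norm_pf_le φ k z
        have h2 := pow_mul_norm_pf_le (d₂iter k φ) 0 z
        have h3 := pow_norm_pf_d₂ k φ z
        have h4 : ‖z‖ ^ k * ‖pf φ z‖ ≤ |z.1| ^ k * ‖pf φ z‖ + |z.2| ^ k * ‖pf φ z‖ := by
          rw [← add_mul]
          gcongr
          rw [Prod.norm_def]
          rcases max_choice ‖z.1‖ ‖z.2‖ with h | h <;> rw [h, Real.norm_eq_abs]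
          · exact le_add_of_nonneg_right (by positivity)
          · exact le_add_of_nonneg_left (by positivity)
        simp only [pow_zero, one_mul, zero_add] at h2
        have h5 : (Real.pi.toNNReal • (q k + q (k + 2) +
            (q 0 + q 2).comp (d₂iter k).toLinearMap)) φ =
            Real.pi * (q k φ + q (k + 2) φ + (q 0 (d₂iter k φ) + q 2 (d₂iter k φ))) := by
          simp [NNReal.smul_def, Real.pi_pos.le]
          ring
        rw [h5]
        simp only [hq]
        linarith)

theorem partialFourier_apply (φ : 𝓢(ℝ × ℝ, ℂ)) (x ω : ℝ) :
    partialFourier φ (x, ω) =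
      ∫ t : ℝ, φ (x, t) * Complex.exp (-(2 * Real.pi * Complex.I) * ω * t) := rfl

/-- The partial Fourier transform in the second variable on tempered distributions. -/
noncomputable def partialFourierDist (u : 𝓢'(ℝ × ℝ, ℂ)) : 𝓢'(ℝ × ℝ, ℂ) :=
  PointwiseConvergenceCLM.precomp ℂ partialFourier u

/-! ### The matrix-Wigner transform -/

/-- The composition `u ∘ T` of a tempered distribution with an invertible linear map,
`⟨u ∘ T, φ⟩ = |det T⁻¹| ⟨u, φ ∘ T⁻¹⟩`. -/
noncomputable def compLinear (T : (ℝ × ℝ) ≃L[ℝ] (ℝ × ℝ)) (u : 𝓢'(ℝ × ℝ, ℂ)) : 𝓢'(ℝ × ℝ, ℂ) :=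
  ((|LinearMap.det (T.symm : (ℝ × ℝ) →ₗ[ℝ] (ℝ × ℝ))| : ℝ) : ℂ) •
    PointwiseConvergenceCLM.precomp ℂ (SchwartzMap.compCLMOfContinuousLinearEquiv ℂ T.symm) u

/-- The matrix-Wigner transform `W_T(μ, ν) = 𝓕₂ ((μ ⊗ conj ν) ∘ T)`. -/
noncomputable def matrixWigner (T : (ℝ × ℝ) ≃L[ℝ] (ℝ × ℝ)) (μ ν : 𝓢'(ℝ, ℂ)) : 𝓢'(ℝ × ℝ, ℂ) :=
  partialFourierDist (compLinear T (tensor μ (conjDist ν)))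

end MatrixWigner

/-! Write `D = a d - b c` and use the coordinates `p = a x + c s`, `q = b x + d s`. Testing `W_T(μ,
ν)` against the functions `lineTest`, which are Fourier transforms in `x` of `P(p) Q(q)`, gives a
nonzero constant times `𝓕 μ P * 𝓕 (conj ν) Q` (`exists_matrixWigner_lineTest`). So a transform
carried by point masses with second coordinate in `B` forces the tensor product of `𝓕 μ` and `𝓕
(conj ν)` onto the parallel lines `(a q - b p) / D = s`, `s ∈ B`. Point masses involve no
derivatives, so near the line with parameter `s` the product is annihilated by `(a q - b p) / D - s`
itself. This is `lineRelation_of_hasSum`.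

Since `b ≠ 0`, these lines are transversal to the direction of `q`. Fixing a test function `Q` of
small support with `𝓕 (conj ν) Q ≠ 0` therefore turns the relation into `(β p + κ - s) 𝓕 μ = 0`
locally, with constants `β ≠ 0` and `κ`. Hence `𝓕 μ` is locally a multiple of a point mass, and its
atoms lie in the uniformly discrete set `β p + κ ∈ B` (`LineRelation.isDiracComb`). The relation is
symmetric in the two factors, so `a ≠ 0` gives the same for `𝓕 (conj ν)`, and a reflection gives it
for `𝓕 ν`. A Dirac comb of this kind is visibly a Radon measure (`IsDiracComb.isMeasure`). -/

namespace MatrixWigner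

/-! ### Compactly supported Schwartz functions on the line -/

section CompactSupport

open Filter Topology
open scoped ContDiff

theorem hasCompactSupport_of_tsupport_subset_ball {f : ℝ → ℂ} {x ε : ℝ}
    (h : tsupport f ⊆ Metric.ball x ε) : HasCompactSupport f :=
  (isCompact_closedBall x ε).of_isClosed_subset (isClosed_tsupport f)
    (h.trans Metric.ball_subset_closedBall)

/-- Averages of a smooth function over segments ending at a moving point are smooth. -/
theorem contDiff_segment_average (z : ℝ) (n : ℕ) : ∀ (k : ℕ) (h : ℝ → ℂ), ContDiff ℝ ∞ h →
    ContDiff ℝ n fun x : ℝ => ∫ t in (0 : ℝ)..1, (t : ℂ) ^ k * h (z + t * (x - z)) := by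
  -- Differentiating under the integral replaces `h` by `deriv h` and produces one more factor `t`.
  -- The weight `t ^ k` makes the family stable under this, so the induction closes.
  have key : ∀ (k : ℕ) (h : ℝ → ℂ), ContDiff ℝ ∞ h → ∀ x₀ : ℝ,
      HasDerivAt (fun x : ℝ => ∫ t in (0 : ℝ)..1, (t : ℂ) ^ k * h (z + t * (x - z)))
        (∫ t in (0 : ℝ)..1, (t : ℂ) ^ (k + 1) * deriv h (z + t * (x₀ - z))) x₀ := by
    intro k h hh x₀
    have hc : Continuous h := hh.continuous
    have hc' : Continuous (deriv h) := hh.continuous_deriv (by simp)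
    have hcont : Continuous fun p : ℝ × ℝ => (p.2 : ℂ) ^ (k + 1) * deriv h (z + p.2 * (p.1 - z)) := by
      fun_prop
    obtain ⟨C, hC⟩ := ((isCompact_closedBall x₀ 1).prod
      (isCompact_Icc (a := (0 : ℝ)) (b := 1))).exists_bound_of_continuousOn hcont.continuousOn
    refine (intervalIntegral.hasDerivAt_integral_of_dominated_loc_of_deriv_le
      (F' := fun x t => (t : ℂ) ^ (k + 1) * deriv h (z + t * (x - z))) (bound := fun _ => C)
      (Metric.closedBall_mem_nhds x₀ one_pos)
      (Eventually.of_forall fun x => Continuous.aestronglyMeasurable (by fun_prop))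
      (Continuous.intervalIntegrable (by fun_prop) _ _)
      (Continuous.aestronglyMeasurable (by fun_prop))
      (ae_of_all _ fun t ht x hx => hC (x, t) ⟨hx, ?_⟩)
      intervalIntegrable_const
      (ae_of_all _ fun t ht x hx => ?_)).2
    · rw [Set.uIoc_of_le zero_le_one] at ht
      exact ⟨ht.1.le, ht.2⟩
    · have h1 : HasDerivAt (fun x : ℝ => z + t * (x - z)) t x := by
        simpa using (((hasDerivAt_id x).sub_const z).const_mul t).const_add z
      have h2 := (((hh.differentiable (by simp)) (z + t * (x - z))).hasDerivAt.scomp x h1).const_mul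
        ((t : ℂ) ^ k)
      refine h2.congr_deriv ?_
      rw [Complex.real_smul]
      ring
  induction n with
  | zero =>
    intro k h hh
    exact contDiff_zero.2 (continuous_iff_continuousAt.2 fun x => (key k h hh x).continuousAt)
  | succ n ih =>
    intro k h hh
    rw [show ((n + 1 : ℕ) : WithTop ℕ∞) = (n : WithTop ℕ∞) + 1 by push_cast; rfl,
      contDiff_succ_iff_deriv]
    refine ⟨fun x => (key k h hh x).differentiableAt, by simp, ?_⟩
    rw [show deriv (fun x : ℝ => ∫ t in (0 : ℝ)..1, (t : ℂ) ^ k * h (z + t * (x - z))) = _ from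
      funext fun x => (key k h hh x).deriv]
    exact ih (k + 1) (deriv h) ((contDiff_infty_iff_deriv.1 hh).2)

/-- Hadamard's lemma on the line. -/
theorem contDiff_dslope {f : ℝ → ℂ} (hf : ContDiff ℝ ∞ f) (z : ℝ) : ContDiff ℝ ∞ (dslope f z) := by
  have e : dslope f z =
      fun x : ℝ => ∫ t in (0 : ℝ)..1, (t : ℂ) ^ 0 * deriv f (z + t * (x - z)) := by
    ext x
    rcases eq_or_ne x z with rfl | hx
    · simp
    · have hc' : Continuous (deriv f) := hf.continuous_deriv (by simp)
      have h1 : ∫ t in (0 : ℝ)..1, (x - z : ℝ) • deriv f (z + t * (x - z)) = f x - f z := by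
        have := intervalIntegral.integral_eq_sub_of_hasDerivAt (a := 0) (b := 1)
          (f := fun t : ℝ => f (z + t * (x - z)))
          (f' := fun t => (x - z : ℝ) • deriv f (z + t * (x - z))) (fun t _ => by
            have h1 : HasDerivAt (fun t : ℝ => z + t * (x - z)) (x - z) t := by
              simpa using ((hasDerivAt_id t).mul_const (x - z)).const_add z
            exact ((hf.differentiable (by simp)) _).hasDerivAt.scomp t h1)
          (Continuous.intervalIntegrable (by fun_prop) _ _)
        simpa using this
      rw [dslope_of_ne _ hx, slope, vsub_eq_sub, ← h1, intervalIntegral.integral_smul, smul_smul,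
        inv_mul_cancel₀ (sub_ne_zero.2 hx), one_smul]
      simp
  rw [e]
  exact contDiff_infty.2 fun n =>
    contDiff_segment_average z n 0 (deriv f) (contDiff_infty_iff_deriv.1 hf).2

/-- A compactly supported smooth function vanishing at the (possibly non-real) point `z` is
divisible by `p - z`. -/
theorem exists_eq_sub_mul (P : 𝓢(ℝ, ℂ)) (hP : HasCompactSupport P) (z : ℂ)
    (hz : ∀ p : ℝ, (p : ℂ) = z → P p = 0) :
    ∃ R : 𝓢(ℝ, ℂ), tsupport R ⊆ tsupport P ∧ ∀ p : ℝ, P p = (p - z) * R p := by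
  obtain ⟨g, hg, hs, he⟩ : ∃ g : ℝ → ℂ, ContDiff ℝ ∞ g ∧ tsupport g ⊆ tsupport P ∧
      ∀ p : ℝ, P p = (p - z) * g p := by
    -- For real `z` the quotient is the divided difference, smooth by Hadamard's lemma. For non-real
    -- `z` the factor `p - z` has no real zero and can simply be inverted.
    by_cases h : ∃ x : ℝ, (x : ℂ) = z
    · obtain ⟨x, rfl⟩ := h
      refine ⟨dslope P x, contDiff_dslope (P.smooth ⊤) x, ?_, fun p => ?_⟩
      · refine closure_minimal (fun p hp => ?_) (isClosed_tsupport _)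
        by_contra hnp
        refine hp ?_
        rcases eq_or_ne p x with rfl | hpx
        · rw [dslope_same]
          exact image_eq_zero_of_notMem_tsupport fun h => hnp (tsupport_deriv_subset h)
        · rw [dslope_of_ne _ hpx, slope, vsub_eq_sub, hz x rfl,
            image_eq_zero_of_notMem_tsupport hnp]
          simp
      · have := sub_smul_dslope (P : ℝ → ℂ) x p
        rw [hz x rfl, sub_zero, Complex.real_smul] at this
        rw [← this]
        push_cast
        rfl
    · push Not at h
      have h0 : ∀ p : ℝ, (p : ℂ) - z ≠ 0 := fun p => sub_ne_zero.2 (h p)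
      refine ⟨fun p => ((p : ℂ) - z)⁻¹ * P p, ?_, tsupport_mul_subset_right, fun p => ?_⟩
      · exact ((Complex.ofRealCLM.contDiff.sub contDiff_const).inv h0).mul (P.smooth ⊤)
      · rw [mul_inv_cancel_left₀ (h0 p)]
  have hgc : HasCompactSupport g := hP.of_isClosed_subset (isClosed_tsupport g) hs
  exact ⟨hgc.toSchwartzMap hg, hs, he⟩

/-- A compactly supported smooth function is a finite sum of smooth functions with small support,
each of which is a multiple of the given one. -/
theorem exists_sum_eq_of_small_support (P : 𝓢(ℝ, ℂ)) (hP : HasCompactSupport P) {ε : ℝ}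
    (hε : 0 < ε) :
    ∃ (t : Finset ℝ) (R : ℝ → 𝓢(ℝ, ℂ)), (∀ x ∈ t, tsupport (R x) ⊆ Metric.ball x ε) ∧
      (∀ x ∈ t, ∀ p, P p = 0 → R x p = 0) ∧ P = ∑ x ∈ t, R x := by
  obtain ⟨t, -, ht⟩ := hP.isCompact.elim_nhds_subcover (fun x => Metric.ball x ε)
    fun x _ => Metric.ball_mem_nhds x hε
  obtain ⟨f, hf⟩ := SmoothPartitionOfUnity.exists_isSubordinate (modelWithCornersSelf ℝ ℝ)
    (isClosed_tsupport (P : ℝ → ℂ)) (fun x : t => Metric.ball (x : ℝ) ε)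
    (fun _ => Metric.isOpen_ball) (by
      intro y hy
      obtain ⟨x, hx, hxy⟩ := Set.mem_iUnion₂.1 (ht hy)
      exact Set.mem_iUnion.2 ⟨⟨x, hx⟩, hxy⟩)
  have hsm : ∀ x : t, ContDiff ℝ ∞ fun p => (f x p : ℂ) * P p := fun x =>
    (Complex.ofRealCLM.contDiff.comp (f x).contMDiff.contDiff).mul (P.smooth ⊤)
  have hco : ∀ x : t, HasCompactSupport fun p => (f x p : ℂ) * P p := fun x => hP.mul_left
  refine ⟨t, fun x => if h : x ∈ t then (hco ⟨x, h⟩).toSchwartzMap (hsm ⟨x, h⟩) else 0,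
    fun x hx => ?_, fun x hx p hp => ?_, ?_⟩
  · simp only [dif_pos hx]
    refine subset_trans ?_ (hf ⟨x, hx⟩)
    refine closure_mono fun p hp => ?_
    have hp' : (f ⟨x, hx⟩ p : ℂ) * P p ≠ 0 := hp
    simp only [ne_eq, mul_eq_zero, not_or, Complex.ofReal_eq_zero] at hp'
    exact hp'.1
  · simp only [dif_pos hx]
    change (f ⟨x, hx⟩ p : ℂ) * P p = 0
    rw [hp, mul_zero]
  · ext p
    rw [sum_apply, ← Finset.sum_attach]
    have e : ∀ x ∈ t.attach, (if h : (x : ℝ) ∈ t then (hco ⟨x, h⟩).toSchwartzMap (hsm ⟨x, h⟩)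
        else 0 : 𝓢(ℝ, ℂ)) p = (f x p : ℂ) * P p := by
      intro x _
      rw [dif_pos x.2]
      rfl
    rw [Finset.sum_congr rfl e, ← Finset.sum_mul]
    by_cases hp : p ∈ tsupport P
    · have h1 := f.sum_eq_one hp
      rw [finsum_eq_sum_of_fintype] at h1
      rw [← Complex.ofReal_sum, show (∑ x ∈ t.attach, f x p) = 1 from h1]
      simp
    · rw [image_eq_zero_of_notMem_tsupport hp, mul_zero]

/-- A nonzero tempered distribution does not vanish on all compactly supported test functions. -/
theorem exists_hasCompactSupport_apply_ne_zero {v : 𝓢'(ℝ, ℂ)} (hv : v ≠ 0) :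
    ∃ Q : 𝓢(ℝ, ℂ), HasCompactSupport Q ∧ v Q ≠ 0 := by
  by_contra! H
  refine hv (DFunLike.ext _ _ fun Q => ?_)
  -- The truncations `χ (c x) Q x` tend to `Q` in the Schwartz seminorms as `c → 0`, at rate `O(c)`;
  -- `v` kills every truncation.
  let χ₀ : ContDiffBump (0 : ℝ) := ⟨1, 2, one_pos, one_lt_two⟩
  have hχc : HasCompactSupport fun x : ℝ => (χ₀ x : ℂ) := by
    refine (isCompact_closedBall (0 : ℝ) 2).of_isClosed_subset (isClosed_tsupport _) ?_
    refine closure_minimal (fun x hx => ?_) Metric.isClosed_closedBall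
    have : x ∈ Function.support χ₀ := fun h => hx (by simp [h])
    rw [χ₀.support_eq] at this
    exact Metric.ball_subset_closedBall this
  let χ : 𝓢(ℝ, ℂ) := hχc.toSchwartzMap (Complex.ofRealCLM.contDiff.comp χ₀.contDiff)
  have hχ1 : ∀ x : ℝ, |x| ≤ 1 → χ x = 1 := fun x hx => by
    change (χ₀ x : ℂ) = 1
    rw [χ₀.one_of_mem_closedBall (by simpa [χ₀] using hx)]
    simp
  set B : ℕ → ℝ := fun i => 1 + SchwartzMap.seminorm ℂ 0 i χ with hB
  have hB0 : ∀ i, 0 ≤ B i := fun i => add_nonneg zero_le_one (apply_nonneg _ _)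
  -- The function `1 - χ (c x)` vanishes where `c |x| < 1`, and elsewhere the factor `c |x|` is at
  -- least `1`. This buys the small factor `c` for one power of `|x|`, which the decay of `Q`
  -- absorbs; hence the index `i.1 + 1` in `K`.
  have hg : ∀ (c : ℝ), 0 < c → c ≤ 1 → ∀ (i : ℕ) (x : ℝ),
      ‖iteratedDeriv i (fun x : ℝ => 1 - χ (c * x)) x‖ ≤ B i * (c * |x|) := by
    intro c hc hc1 i x
    rcases lt_or_ge (c * |x|) 1 with hx | hx
    · have : (fun x : ℝ => 1 - χ (c * x)) =ᶠ[𝓝 x] fun _ => 0 := by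
        have : ∀ᶠ y in 𝓝 x, c * |y| < 1 :=
          (continuous_const.mul continuous_abs).continuousAt.eventually_lt continuousAt_const hx
        filter_upwards [this] with y hy
        rw [hχ1 _ (by rw [abs_mul, abs_of_pos hc]; exact hy.le), sub_self]
      rw [this.iteratedDeriv_eq]
      have h0 : iteratedDeriv i (fun _ : ℝ => (0 : ℂ)) x = 0 := by
        simp
      rw [h0, norm_zero]
      have := hB0 i
      positivity
    · refine le_trans ?_ (le_mul_of_one_le_right (hB0 i) hx)
      have h1 : ContDiffAt ℝ i (fun x : ℝ => χ (c * x)) x :=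
        ((χ.smooth i).comp (contDiff_const.mul contDiff_id)).contDiffAt
      have e : iteratedDeriv i (fun x : ℝ => 1 - χ (c * x)) x =
          iteratedDeriv i (fun _ : ℝ => (1 : ℂ)) x - iteratedDeriv i (fun x : ℝ => χ (c * x)) x :=
        iteratedDeriv_fun_sub contDiffAt_const h1
      rw [e, iteratedDeriv_comp_const_smul (χ.smooth i) c]
      refine (norm_sub_le _ _).trans (add_le_add ?_ ?_)
      · rw [iteratedDeriv_const]
        split_ifs <;> simp
      · rw [norm_smul, norm_pow, Real.norm_eq_abs, abs_of_pos hc]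
        have := SchwartzMap.le_seminorm' ℂ 0 i χ (c * x)
        rw [pow_zero, one_mul] at this
        exact (mul_le_of_le_one_left (norm_nonneg _) (pow_le_one₀ hc.le hc1)).trans this
  obtain ⟨s, C, hC, hb⟩ := exists_bound v
  set K : ℝ := C * ∑ i ∈ s, ∑ j ∈ Finset.range (i.2 + 1), (i.2.choose j : ℝ) * B j *
    SchwartzMap.seminorm ℂ (i.1 + 1) (i.2 - j) Q with hK
  have hQ : ∀ c : ℝ, 0 < c → c ≤ 1 → ‖v Q‖ ≤ K * c := by
    intro c hc hc1
    have hsm : ContDiff ℝ ∞ fun x : ℝ => χ (c * x) :=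
      (χ.smooth ⊤).comp (contDiff_const.mul contDiff_id)
    have hcc : HasCompactSupport fun x : ℝ => χ (c * x) * Q x := by
      have : HasCompactSupport fun x : ℝ => χ (c * x) :=
        hχc.comp_homeomorph (Homeomorph.mulLeft₀ c hc.ne')
      exact this.mul_right
    let R : 𝓢(ℝ, ℂ) := hcc.toSchwartzMap (hsm.mul (Q.smooth ⊤))
    have e : v Q = v (Q - R) := by rw [map_sub, H R hcc, sub_zero]
    rw [e, hK, mul_assoc, Finset.sum_mul]
    refine (hb _).trans ?_
    gcongr with i
    refine SchwartzMap.seminorm_le_bound' ℂ i.1 i.2 _ ?_ fun x => ?_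
    · exact mul_nonneg (Finset.sum_nonneg fun j _ => mul_nonneg
        (mul_nonneg (Nat.cast_nonneg _) (hB0 j)) (apply_nonneg _ _)) hc.le
    · have e2 : ((Q - R : 𝓢(ℝ, ℂ)) : ℝ → ℂ) = fun y => (1 - χ (c * y)) * Q y := by
        ext y
        change Q y - χ (c * y) * Q y = _
        ring
      have hm := norm_iteratedFDeriv_mul_le (𝕜 := ℝ) (N := ∞) (contDiff_const (c := (1 : ℂ)).sub hsm)
        (Q.smooth ⊤) x (n := i.2) (by exact_mod_cast le_top)
      simp only [norm_iteratedFDeriv_eq_norm_iteratedDeriv] at hm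
      rw [e2]
      refine (mul_le_mul_of_nonneg_left hm (by positivity)).trans ?_
      rw [Finset.mul_sum, Finset.sum_mul]
      refine Finset.sum_le_sum fun j _ => ?_
      have h1 := hg c hc hc1 j x
      have h2 := SchwartzMap.le_seminorm' ℂ (i.1 + 1) (i.2 - j) Q x
      have h3 := hB0 j
      calc |x| ^ i.1 * ((i.2.choose j : ℝ) * ‖iteratedDeriv j (fun x : ℝ => 1 - χ (c * x)) x‖ *
            ‖iteratedDeriv (i.2 - j) Q x‖)
          ≤ |x| ^ i.1 * ((i.2.choose j : ℝ) * (B j * (c * |x|)) *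
            ‖iteratedDeriv (i.2 - j) Q x‖) := by gcongr
        _ = (i.2.choose j : ℝ) * B j * (|x| ^ (i.1 + 1) * ‖iteratedDeriv (i.2 - j) Q x‖) * c := by
            ring
        _ ≤ _ := by gcongr
  have hlim : Tendsto (fun n : ℕ => K * (1 / ((n : ℝ) + 1))) atTop (𝓝 0) := by
    simpa using tendsto_one_div_add_atTop_nhds_zero_nat.const_mul K
  have : ‖v Q‖ ≤ 0 := ge_of_tendsto' hlim fun n => hQ _ (by positivity)
    (by rw [div_le_one (by positivity)]; linarith [Nat.cast_nonneg (α := ℝ) n])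
  simpa using this

/-- A nonzero tempered distribution does not vanish on some test function of small support. -/
theorem exists_small_support_apply_ne_zero {v : 𝓢'(ℝ, ℂ)} (hv : v ≠ 0) {ε : ℝ} (hε : 0 < ε) :
    ∃ (x : ℝ) (Q : 𝓢(ℝ, ℂ)), tsupport Q ⊆ Metric.ball x ε ∧ v Q ≠ 0 := by
  obtain ⟨Q, hQc, hQ⟩ := exists_hasCompactSupport_apply_ne_zero hv
  obtain ⟨t, R, hR, -, rfl⟩ := exists_sum_eq_of_small_support Q hQc hε
  rw [map_sum] at hQ
  obtain ⟨x, hx, h⟩ := Finset.exists_ne_zero_of_sum_ne_zero hQ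
  exact ⟨x, R x, hR x hx, h⟩

end CompactSupport

/-! ### Distributions which are locally finite combinations of point masses -/

theorem ofReal_hasTemperateGrowth : Function.HasTemperateGrowth fun p : ℝ => (p : ℂ) :=
  Complex.ofRealCLM.hasTemperateGrowth

/-- Multiplication by the variable. -/
noncomputable def mulId : 𝓢(ℝ, ℂ) →L[ℂ] 𝓢(ℝ, ℂ) :=
  SchwartzMap.smulLeftCLM ℂ fun p : ℝ => (p : ℂ)

@[simp]
theorem mulId_apply (P : 𝓢(ℝ, ℂ)) (p : ℝ) : mulId P p = p * P p := by
  rw [mulId, SchwartzMap.smulLeftCLM_apply_apply ofReal_hasTemperateGrowth, smul_eq_mul]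

theorem tsupport_mulId_subset (P : 𝓢(ℝ, ℂ)) : tsupport (mulId P) ⊆ tsupport P :=
  SchwartzMap.tsupport_smulLeftCLM_subset _ _ |>.trans Set.inter_subset_left

/-- A tempered distribution is a Dirac comb if it depends only on the values of the test function
on some uniformly discrete set. -/
def IsDiracComb (u : 𝓢'(ℝ, ℂ)) : Prop :=
  ∃ S : Set ℝ, UniformlyDiscrete S ∧
    ∀ P : 𝓢(ℝ, ℂ), HasCompactSupport P → (∀ p ∈ S, P p = 0) → u P = 0

/-- The identity `(β p + α q - s) (u ⊗ v) = 0` near those points of the plane where `s` is the only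
possible value of `β p + α q` in `B`. -/
def LineRelation (B : Set ℝ) (α β : ℝ) (u v : 𝓢'(ℝ, ℂ)) : Prop :=
  ∀ P Q : 𝓢(ℝ, ℂ), HasCompactSupport P → HasCompactSupport Q → ∀ s : ℝ,
    (∀ p ∈ tsupport P, ∀ q ∈ tsupport Q, β * p + α * q ∈ B → β * p + α * q = s) →
      β * (u (mulId P) * v Q) + α * (u P * v (mulId Q)) = s * (u P * v Q)

theorem LineRelation.symm {B : Set ℝ} {α β : ℝ} {u v : 𝓢'(ℝ, ℂ)} (h : LineRelation B α β u v) :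
    LineRelation B β α v u := fun P Q hP hQ s hs => by
  have := h Q P hQ hP s fun q hq p hp hB => by
    rw [add_comm] at hB ⊢
    exact hs p hp q hq hB
  linear_combination this

/-- Freezing one `Q` with `v Q ≠ 0` replaces `α q` by its average `κ` against `v`, and the relation
reads `(β p + κ - s) u = 0` locally. The same `κ` serves at every location, so the local atoms fit
into a single affine preimage of `B`. -/
theorem LineRelation.isDiracComb {B : Set ℝ} {α β : ℝ} {u v : 𝓢'(ℝ, ℂ)}
    (h : LineRelation B α β u v) (hB : UniformlyDiscrete B) (hβ : β ≠ 0) (hv : v ≠ 0) :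
    IsDiracComb u := by
  obtain ⟨δ, hδ, hsep⟩ := hB
  -- With `p` and `q` within `ε` of their centres, `β p + α q` moves by less than `δ / 2`, so it can
  -- meet at most one point of `B`.
  set ε : ℝ := δ / (2 * (|α| + |β|)) with hε
  have hβ' : 0 < |β| := abs_pos.2 hβ
  have hαβ : 0 < |α| + |β| := by positivity
  have hε0 : 0 < ε := by positivity
  obtain ⟨q₀, Q, hQs, hQ⟩ := exists_small_support_apply_ne_zero hv hε0
  have hQc : HasCompactSupport Q := hasCompactSupport_of_tsupport_subset_ball hQs
  -- As `v` is complex-valued, `κ` need not be real. If it is not, the set chosen below is empty and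
  -- `u` kills every compactly supported test function.
  set κ : ℂ := α * v (mulId Q) / v Q with hκ
  have hκQ : κ * v Q = α * v (mulId Q) := div_mul_cancel₀ _ hQ
  have hβC : (β : ℂ) ≠ 0 := by exact_mod_cast hβ
  refine ⟨{p : ℝ | ∃ s ∈ B, (β : ℂ) * p + κ = s}, ⟨δ / |β|, by positivity, ?_⟩, ?_⟩
  · rintro p ⟨s, hs, hps⟩ p' ⟨s', hs', hps'⟩ hne
    have e : β * (p - p') = s - s' := by
      have : (β : ℂ) * (p - p') = s - s' := by linear_combination hps - hps'
      exact_mod_cast this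
    have hne' : s ≠ s' := by
      intro hss
      rw [hss, sub_self] at e
      exact hne (sub_eq_zero.1 ((mul_eq_zero.1 e).resolve_left hβ))
    rw [div_le_iff₀' hβ', ← abs_mul, e]
    exact hsep s hs s' hs' hne'
  · have hloc : ∀ (x : ℝ) (P : 𝓢(ℝ, ℂ)), tsupport P ⊆ Metric.ball x ε →
        (∀ p : ℝ, (∃ s ∈ B, (β : ℂ) * p + κ = s) → P p = 0) → u P = 0 := by
      intro x P hPs hP
      have hPc : HasCompactSupport P := hasCompactSupport_of_tsupport_subset_ball hPs
      have hclose : ∀ p ∈ Metric.ball x ε, ∀ q ∈ tsupport Q,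
          |β * p + α * q - (β * x + α * q₀)| < δ / 2 := by
        intro p hp q hq
        have h1 : |p - x| < ε := hp
        have h2 : |q - q₀| < ε := hQs hq
        have e : β * p + α * q - (β * x + α * q₀) = β * (p - x) + α * (q - q₀) := by ring
        have h3 : (|α| + |β|) * ε = δ / 2 := by
          rw [hε]
          field_simp
        rw [e, ← h3]
        refine (abs_add_le _ _).trans_lt ?_
        rw [abs_mul, abs_mul]
        nlinarith [mul_lt_mul_of_pos_left h1 hβ', mul_le_mul_of_nonneg_left h2.le (abs_nonneg α)]
      by_cases hex : ∃ s ∈ B, |s - (β * x + α * q₀)| < δ / 2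
      · obtain ⟨s, hs, hsx⟩ := hex
        have huniq : ∀ R : 𝓢(ℝ, ℂ), tsupport R ⊆ Metric.ball x ε → ∀ p ∈ tsupport R,
            ∀ q ∈ tsupport Q, β * p + α * q ∈ B → β * p + α * q = s := by
          intro R hR p hp q hq hmem
          by_contra hne
          have h1 := hsep _ hmem s hs hne
          have h2 := hclose p (hR hp) q hq
          have h3 := abs_sub_le (β * p + α * q) (β * x + α * q₀) s
          rw [abs_sub_comm (β * x + α * q₀) s] at h3
          linarith
        -- The only possible atom here is the root of `β p + κ - s`. As `P` vanishes there, it is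
        -- divisible by `p - (s - κ) / β`, and the relation applied to the quotient gives `u P = 0`.
        obtain ⟨R, hR, hPR⟩ := exists_eq_sub_mul P hPc ((s - κ) / β) fun p hp => hP p ⟨s, hs, by
          rw [hp]
          field_simp
          ring⟩
        have hrel := h R Q (hasCompactSupport_of_tsupport_subset_ball (hR.trans hPs)) hQc s
          (huniq R (hR.trans hPs))
        have e : P = mulId R - ((s - κ) / β : ℂ) • R := by
          ext p
          rw [hPR p, sub_apply, smul_apply, mulId_apply, smul_eq_mul]
          ring
        have h4 : (β * u (mulId R) + κ * u R - s * u R) * v Q = 0 := by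
          linear_combination hrel + u R * hκQ
        have h5 := (mul_eq_zero.1 h4).resolve_right hQ
        rw [e, map_sub, map_smul, smul_eq_mul]
        field_simp
        linear_combination h5
      · push Not at hex
        -- No point of `B` is within reach, so the relation holds for every `s`. Its left side does
        -- not depend on `s`, and comparing `s = 0` with `s = 1` gives `u P * v Q = 0`.
        have hnone : ∀ s : ℝ, ∀ p ∈ tsupport P, ∀ q ∈ tsupport Q, β * p + α * q ∈ B →
            β * p + α * q = s := fun s p hp q hq hmem =>
          absurd (hclose p (hPs hp) q hq) (not_lt.2 (hex _ hmem))
        have h0 := h P Q hPc hQc 0 (hnone 0)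
        have h1 := h P Q hPc hQc 1 (hnone 1)
        rw [h0] at h1
        have : u P * v Q = 0 := by simpa using h1.symm
        exact (mul_eq_zero.1 this).resolve_right hQ
    intro P hPc hP
    obtain ⟨t, R, hR, hR0, rfl⟩ := exists_sum_eq_of_small_support P hPc hε0
    rw [map_sum]
    exact Finset.sum_eq_zero fun x hx => hloc x (R x) (hR x hx) fun p hp => hR0 x hx p (hP p hp)

/-! ### Uniformly discrete sets, and Dirac combs as Radon measures. -/

theorem UniformlyDiscrete.isClosed {S : Set ℝ} (hS : UniformlyDiscrete S) : IsClosed S := by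
  obtain ⟨δ, hδ, h⟩ := hS
  exact Metric.isClosed_of_pairwise_le_dist hδ fun r hr s hs hne => h r hr s hs hne

theorem UniformlyDiscrete.discreteTopology {S : Set ℝ} (hS : UniformlyDiscrete S) :
    DiscreteTopology S := by
  obtain ⟨δ, hδ, h⟩ := hS
  exact DiscreteTopology.of_forall_le_dist hδ fun r s hne =>
    h r r.2 s s.2 fun e => hne (Subtype.ext e)

theorem UniformlyDiscrete.countable {S : Set ℝ} (hS : UniformlyDiscrete S) : Countable S :=
  have := hS.discreteTopology
  TopologicalSpace.separableSpace_iff_countable.1 inferInstance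

theorem UniformlyDiscrete.finite_inter {S K : Set ℝ} (hS : UniformlyDiscrete S)
    (hK : IsCompact K) : (S ∩ K).Finite := by
  obtain ⟨δ, hδ, h⟩ := hS
  have hSK : UniformlyDiscrete (S ∩ K) := ⟨δ, hδ, fun r hr s hs => h r hr.1 s hs.1⟩
  have := hSK.discreteTopology
  exact (hK.of_isClosed_subset hSK.isClosed Set.inter_subset_right).finite ⟨this⟩

theorem IsDiracComb.exists_dsupport_subset {u : 𝓢'(ℝ, ℂ)} (hu : IsDiracComb u) :
    ∃ S : Set ℝ, UniformlyDiscrete S ∧ Distribution.dsupport u ⊆ S := by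
  obtain ⟨S, hS, h⟩ := hu
  refine ⟨S, hS, fun x hx => ?_⟩
  by_contra hxS
  refine (Distribution.notMem_dsupport_iff (f := u) x).2
    ⟨Sᶜ ∩ Metric.ball x 1, fun P hP => ?_, hS.isClosed.isOpen_compl.inter Metric.isOpen_ball,
      hxS, Metric.mem_ball_self one_pos⟩ hx
  exact h P (hasCompactSupport_of_tsupport_subset_ball (hP.trans Set.inter_subset_right))
    fun p hp => image_eq_zero_of_notMem_tsupport fun hp' => (hP hp').1 hp

/-- The mass at `p` is `u (χ p)` for a bump `χ p` which equals `1` at `p` and, by the separation,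
vanishes at the other points of `S`. Subtracting the finitely many relevant `P p • χ p` from `P`
leaves a function vanishing on `S`. -/
theorem IsDiracComb.exists_eq_tsum {u : 𝓢'(ℝ, ℂ)} (hu : IsDiracComb u) :
    ∃ (S : Set ℝ) (m : ℝ → ℂ), UniformlyDiscrete S ∧ ∀ P : 𝓢(ℝ, ℂ), HasCompactSupport P →
      u P = ∑' p : S, m p * P p := by
  obtain ⟨S, hS, h⟩ := hu
  obtain ⟨δ, hδ, hsep⟩ := hS
  have hχ : ∀ p : ℝ, ∃ χ : 𝓢(ℝ, ℂ), tsupport χ ⊆ Metric.ball p δ ∧ χ p = 1 := fun p => by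
    obtain ⟨f, h₁, h₂, h₃, -, h₄⟩ :=
      exists_contDiff_tsupport_subset (n := ⊤) (Metric.ball_mem_nhds p hδ)
    have h₂' : HasCompactSupport (Complex.ofRealCLM ∘ f) := h₂.comp_left rfl
    have h₁' : tsupport (Complex.ofRealCLM ∘ f) ⊆ Metric.ball p δ :=
      (tsupport_comp_subset rfl _).trans h₁
    exact ⟨h₂'.toSchwartzMap (Complex.ofRealCLM.contDiff.comp h₃), h₁', by simp [h₄]⟩
  choose χ hχs hχ1 using hχ
  have hχ0 : ∀ p ∈ S, ∀ q ∈ S, q ≠ p → χ p q = 0 := fun p hp q hq hne =>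
    image_eq_zero_of_notMem_tsupport fun hmem =>
      absurd (hχs p hmem : |q - p| < δ) (not_lt.2 (hsep q hq p hp hne))
  refine ⟨S, fun p => u (χ p), ⟨δ, hδ, hsep⟩, fun P hP => ?_⟩
  have hfin : {p : S | (p : ℝ) ∈ S ∩ tsupport P}.Finite :=
    (UniformlyDiscrete.finite_inter ⟨δ, hδ, hsep⟩ hP.isCompact).preimage
      Subtype.val_injective.injOn
  set F := hfin.toFinset with hF
  have hout : ∀ p : S, p ∉ F → P p = 0 := fun p hp =>
    image_eq_zero_of_notMem_tsupport fun hmem => hp (hfin.mem_toFinset.2 ⟨p.2, hmem⟩)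
  rw [tsum_eq_sum (s := F) fun p hp => by rw [hout p hp, mul_zero]]
  have hcs : ∀ p, HasCompactSupport (χ p) := fun p =>
    hasCompactSupport_of_tsupport_subset_ball (hχs p)
  have hR : u (P - ∑ p ∈ F, P (p : ℝ) • χ (p : ℝ)) = 0 := by
    refine h _ ?_ fun q hq => ?_
    · refine HasCompactSupport.intro
        (hP.isCompact.union (F.isCompact_biUnion fun p _ => (hcs (p : ℝ)).isCompact))
        fun x hx => ?_
      simp only [Set.mem_union, Set.mem_iUnion, not_or, not_exists] at hx
      rw [sub_apply, sum_apply, image_eq_zero_of_notMem_tsupport hx.1, zero_sub, neg_eq_zero]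
      refine Finset.sum_eq_zero fun p hp => ?_
      rw [smul_apply, image_eq_zero_of_notMem_tsupport (hx.2 p hp), smul_zero]
    · rw [sub_apply, sum_apply, Finset.sum_eq_single (⟨q, hq⟩ : S)]
      · rw [smul_apply, hχ1, smul_eq_mul, mul_one, sub_self]
      · intro p _ hne
        rw [smul_apply, hχ0 p p.2 q hq fun e => hne (Subtype.ext e.symm), smul_zero]
      · intro hq'
        rw [smul_apply, hout _ hq', zero_smul]
  rw [map_sub, sub_eq_zero] at hR
  rw [hR, map_sum]
  refine Finset.sum_congr rfl fun p _ => ?_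
  rw [map_smul, smul_eq_mul, mul_comm]

theorem UniformlyDiscrete.isLocallyFiniteMeasure_sum_dirac {S : Set ℝ} (hS : UniformlyDiscrete S)
    (w : S → ENNReal) (hw : ∀ p, w p ≠ ⊤) :
    IsLocallyFiniteMeasure (Measure.sum fun p : S => w p • Measure.dirac (p : ℝ)) := by
  obtain ⟨δ, hδ, hsep⟩ := hS
  -- A ball of radius `δ / 2` contains at most one point of `S`.
  refine ⟨fun x => ⟨Metric.ball x (δ / 2), Metric.ball_mem_nhds x (by positivity), ?_⟩⟩
  rw [Measure.sum_apply _ Metric.isOpen_ball.measurableSet]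
  simp only [Measure.smul_apply, smul_eq_mul,
    Measure.dirac_apply' _ (Metric.isOpen_ball (x := x) (ε := δ / 2)).measurableSet]
  by_cases hex : ∃ p : S, (p : ℝ) ∈ Metric.ball x (δ / 2)
  · obtain ⟨p, hp⟩ := hex
    rw [tsum_eq_single p fun q hqp => ?_]
    · simp [hp, (hw p).lt_top]
    · have : (q : ℝ) ∉ Metric.ball x (δ / 2) := fun hq => by
        have h1 := hsep q q.2 p p.2 fun e => hqp (Subtype.ext e)
        have h2 : |(q : ℝ) - x| < δ / 2 := hq
        have h3 : |(p : ℝ) - x| < δ / 2 := hp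
        have h4 := abs_sub_le (q : ℝ) x p
        rw [abs_sub_comm x] at h4
        linarith
      simp [this]
  · push Not at hex
    have : ∀ p : S, w p * (Metric.ball x (δ / 2)).indicator 1 (p : ℝ) = 0 := fun p => by
      simp [hex p]
    simp [this]

theorem IsDiracComb.isMeasure {u : 𝓢'(ℝ, ℂ)} (hu : IsDiracComb u) : IsMeasure u := by
  classical
  obtain ⟨S, m, hS, h⟩ := hu.exists_eq_tsum
  have := hS.countable
  -- The phase of the masses, set to `1` elsewhere so that its modulus is one everywhere. It is
  -- measurable because it differs from `1` only on a countable set.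
  set g : ℝ → ℂ := fun p => if p ∈ S ∧ m p ≠ 0 then m p / ‖m p‖ else 1 with hg
  refine ⟨Measure.sum fun p : S => ENNReal.ofReal ‖m p‖ • Measure.dirac (p : ℝ), g,
    hS.isLocallyFiniteMeasure_sum_dirac _ fun _ => ENNReal.ofReal_ne_top, ?_, fun x => ?_,
    fun P hP => ?_⟩
  · refine (measurable_const (a := (1 : ℂ))).measurable_of_countable_ne
      ((Set.countable_coe_iff.1 this).mono fun x hx => ?_)
    by_contra hxS
    exact hx (by simp [hg, hxS])
  · simp only [hg]
    split_ifs with hx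
    · simp [hx.2]
    · simp
  · rw [h P hP, integral_sum_dirac fun _ => ENNReal.ofReal_ne_top]
    refine tsum_congr fun p => ?_
    rw [ENNReal.toReal_ofReal (norm_nonneg _), Complex.real_smul]
    rcases eq_or_ne (m p) 0 with h0 | h0
    · simp [h0]
    · have hn : (‖m p‖ : ℂ) ≠ 0 := by simpa using h0
      simp only [hg, p.2, h0, ne_eq, not_false_eq_true, and_self, if_true]
      field_simp

/-! ### Test functions separating the Fourier transforms of the two factors -/

section Pullback

open scoped ContDiff

/-- The linear change of variables `(s, x) ↦ (a x + c s, b x + d s)`. -/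
noncomputable def coordChange (a b c d : ℝ) (hD : a * d - b * c ≠ 0) :
    (ℝ × ℝ) ≃L[ℝ] (ℝ × ℝ) :=
  ContinuousLinearEquiv.equivOfInverse
    ((a • ContinuousLinearMap.snd ℝ ℝ ℝ + c • ContinuousLinearMap.fst ℝ ℝ ℝ).prod
      (b • ContinuousLinearMap.snd ℝ ℝ ℝ + d • ContinuousLinearMap.fst ℝ ℝ ℝ))
    ((a * d - b * c)⁻¹ •
      (a • ContinuousLinearMap.snd ℝ ℝ ℝ - b • ContinuousLinearMap.fst ℝ ℝ ℝ).prod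
        (d • ContinuousLinearMap.fst ℝ ℝ ℝ - c • ContinuousLinearMap.snd ℝ ℝ ℝ))
    (fun z => by
      ext
      · simp
        field_simp
        ring
      · simp
        field_simp
        ring)
    (fun z => by
      ext
      · simp
        field_simp
        ring
      · simp
        field_simp
        ring)

variable {a b c d : ℝ} (hD : a * d - b * c ≠ 0)

@[simp]
theorem coordChange_apply (s x : ℝ) :
    coordChange a b c d hD (s, x) = (a * x + c * s, b * x + d * s) := rfl

theorem hasCompactSupport_mul_prod {P Q : ℝ → ℂ} (hP : HasCompactSupport P)
    (hQ : HasCompactSupport Q) : HasCompactSupport fun z : ℝ × ℝ => P z.1 * Q z.2 := by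
  refine HasCompactSupport.intro (hP.isCompact.prod hQ.isCompact) fun z hz => ?_
  by_cases h1 : z.1 ∈ tsupport P
  · rw [image_eq_zero_of_notMem_tsupport (f := Q) fun h2 => hz ⟨h1, h2⟩, mul_zero]
  · rw [image_eq_zero_of_notMem_tsupport h1, zero_mul]

/-- The function `(r, s) ↦ ∫ P (a x + c s) Q (b x + d s) exp (-2πirx) dx`. -/
noncomputable def lineTest (P Q : 𝓢(ℝ, ℂ)) (hP : HasCompactSupport P) (hQ : HasCompactSupport Q) :
    𝓢(ℝ × ℝ, ℂ) :=
  -- The inner transform acts on `x`, the second entry of `(s, x)`, and yields a function of `(s,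
  -- r)`; the swap puts `r` first.
  SchwartzMap.compCLMOfContinuousLinearEquiv ℂ (ContinuousLinearEquiv.prodComm ℝ ℝ ℝ)
    (partialFourier (SchwartzMap.compCLMOfContinuousLinearEquiv ℂ (coordChange a b c d hD)
      ((hasCompactSupport_mul_prod hP hQ).toSchwartzMap
        (((P.smooth ⊤).comp contDiff_fst).mul ((Q.smooth ⊤).comp contDiff_snd)))))

variable (P Q : 𝓢(ℝ, ℂ)) (hP : HasCompactSupport P) (hQ : HasCompactSupport Q)

theorem lineTest_apply (r s : ℝ) :
    lineTest hD P Q hP hQ (r, s) = ∫ x : ℝ, P (a * x + c * s) * Q (b * x + d * s) *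
      Complex.exp (-(2 * Real.pi * Complex.I) * r * x) := rfl

theorem fourier_apply_eq_integral (f : 𝓢(ℝ, ℂ)) (ξ : ℝ) :
    𝓕 f ξ = ∫ t : ℝ, f t * Complex.exp (-(2 * Real.pi * Complex.I) * ξ * t) := by
  rw [SchwartzMap.fourier_coe, Real.fourier_real_eq_integral_exp_smul]
  congr 1
  ext t
  rw [smul_eq_mul, mul_comm]
  congr 2
  push_cast
  ring

theorem exists_integral_comp_eq (L : (ℝ × ℝ) ≃L[ℝ] (ℝ × ℝ)) :
    ∃ C : ℂ, C ≠ 0 ∧ ∀ F : ℝ × ℝ → ℂ, ∫ z, F (L z) = C * ∫ z, F z := by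
  have hdet : LinearMap.det (L : (ℝ × ℝ) →ₗ[ℝ] (ℝ × ℝ)) ≠ 0 :=
    (LinearEquiv.isUnit_det' L.toLinearEquiv).ne_zero
  refine ⟨(|(LinearMap.det (L : (ℝ × ℝ) →ₗ[ℝ] (ℝ × ℝ)))⁻¹| : ℝ), ?_, fun F => ?_⟩
  · simpa using hdet
  · have h := Measure.map_linearMap_addHaar_eq_smul_addHaar (volume : Measure (ℝ × ℝ)) hdet
    have h2 := (L.toHomeomorph.measurableEmbedding).integral_map (μ := volume) F
    change ∫ z, F z ∂(Measure.map (L : (ℝ × ℝ) →ₗ[ℝ] (ℝ × ℝ)) volume) = ∫ z, F (L z) at h2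
    rw [← h2, h, integral_smul_measure, ENNReal.toReal_ofReal (abs_nonneg _), Complex.real_smul]

/-- Transforming `s` as well gives the full Fourier transform of `P ⊗ Q` after a linear change of
variables, which acts on frequencies by the transpose: `X x + Y s = ξ (a x + c s) + η (b x + d s)`.
The point of evaluation is `T⁻¹ (ξ, η)`, so composition with `T` will cancel. -/
theorem exists_partialFourier_lineTest :
    ∃ C : ℂ, C ≠ 0 ∧ ∀ (P Q : 𝓢(ℝ, ℂ)) (hP : HasCompactSupport P) (hQ : HasCompactSupport Q)
      (ξ η : ℝ), partialFourier (lineTest hD P Q hP hQ) (a * ξ + b * η, c * ξ + d * η) =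
        C * (𝓕 P ξ * 𝓕 Q η) := by
  obtain ⟨C, hC, h⟩ := exists_integral_comp_eq (coordChange a b c d hD)
  refine ⟨C, hC, fun P Q hP hQ ξ η => ?_⟩
  set X := a * ξ + b * η with hX
  set Y := c * ξ + d * η with hY
  set G : 𝓢(ℝ × ℝ, ℂ) := SchwartzMap.compCLMOfContinuousLinearEquiv ℂ (coordChange a b c d hD)
      ((hasCompactSupport_mul_prod hP hQ).toSchwartzMap
        (((P.smooth ⊤).comp contDiff_fst).mul ((Q.smooth ⊤).comp contDiff_snd))) with hG
  set F : ℝ × ℝ → ℂ := fun z => (P z.1 * Complex.exp (-(2 * Real.pi * Complex.I) * ξ * z.1)) *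
    (Q z.2 * Complex.exp (-(2 * Real.pi * Complex.I) * η * z.2)) with hF
  have hFL : ∀ s x : ℝ, F (coordChange a b c d hD (s, x)) =
      G (s, x) * Complex.exp (-(2 * Real.pi * Complex.I) * X * x) *
        Complex.exp (-(2 * Real.pi * Complex.I) * Y * s) := by
    intro s x
    have e1 : G (s, x) = P (a * x + c * s) * Q (b * x + d * s) := rfl
    rw [e1, mul_assoc, ← Complex.exp_add]
    simp only [hF, coordChange_apply]
    rw [mul_mul_mul_comm, ← Complex.exp_add]
    congr 2
    rw [hX, hY]
    push_cast
    ring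
  have hint : Integrable (fun z : ℝ × ℝ => F (coordChange a b c d hD z))
      ((volume : Measure ℝ).prod volume) := by
    have hGi : Integrable G ((volume : Measure ℝ).prod volume) := G.integrable (μ := volume)
    have e : (fun z : ℝ × ℝ => F (coordChange a b c d hD z)) = fun z =>
        G z * (Complex.exp (-(2 * Real.pi * Complex.I) * X * z.2) *
          Complex.exp (-(2 * Real.pi * Complex.I) * Y * z.1)) := by
      ext z
      rw [← mul_assoc]
      exact hFL z.1 z.2
    rw [e]
    refine hGi.mul_bdd (c := 1) (by fun_prop) (Filter.Eventually.of_forall fun z => ?_)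
    rw [norm_mul, norm_exp_eq, norm_exp_eq, mul_one]
  calc partialFourier (lineTest hD P Q hP hQ) (X, Y)
      = ∫ s : ℝ, ∫ x : ℝ, F (coordChange a b c d hD (s, x)) := by
        rw [partialFourier_apply]
        congr 1
        ext s
        rw [lineTest_apply, ← integral_mul_const]
        congr 1
        ext x
        rw [hFL]
        rfl
    _ = ∫ z : ℝ × ℝ, F (coordChange a b c d hD z) := (integral_prod _ hint).symm
    _ = C * ∫ z : ℝ × ℝ, F z := h F
    _ = C * (𝓕 P ξ * 𝓕 Q η) := by
        rw [fourier_apply_eq_integral, fourier_apply_eq_integral, ← integral_prod_mul]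
        rfl

end Pullback

/-! ### The line relation for a matrix-Wigner transform. -/

theorem tensor_apply_of_eq_mul (u v : 𝓢'(ℝ, ℂ)) (ψ : 𝓢(ℝ × ℝ, ℂ)) (f g : 𝓢(ℝ, ℂ)) (C : ℂ)
    (h : ∀ x y, ψ (x, y) = C * (f x * g y)) : tensor u v ψ = C * (u f * v g) := by
  have e : applySnd v ψ = (C * v g) • f := by
    ext x
    have e2 : slice x ψ = (C * f x) • g := by
      ext y
      rw [slice_apply, h, smul_apply, smul_eq_mul]
      ring
    rw [applySnd_apply, e2, map_smul, smul_apply, smul_eq_mul, smul_eq_mul]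
    ring
  rw [tensor_apply, e, map_smul, smul_eq_mul]
  ring

theorem exists_matrixWigner_lineTest (T : (ℝ × ℝ) ≃L[ℝ] (ℝ × ℝ)) {a b c d : ℝ}
    (hT : ∀ x y : ℝ, T.symm (x, y) = (a * x + b * y, c * x + d * y)) (hD : a * d - b * c ≠ 0)
    (μ ν : 𝓢'(ℝ, ℂ)) :
    ∃ C : ℂ, C ≠ 0 ∧ ∀ (P Q : 𝓢(ℝ, ℂ)) (hP : HasCompactSupport P) (hQ : HasCompactSupport Q),
      matrixWigner T μ ν (lineTest hD P Q hP hQ) = C * (𝓕 μ P * 𝓕 (conjDist ν) Q) := by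
  obtain ⟨C, hC, h⟩ := exists_partialFourier_lineTest hD
  have hdet : LinearMap.det (T.symm : (ℝ × ℝ) →ₗ[ℝ] (ℝ × ℝ)) ≠ 0 :=
    (LinearEquiv.isUnit_det' T.symm.toLinearEquiv).ne_zero
  refine ⟨(|LinearMap.det (T.symm : (ℝ × ℝ) →ₗ[ℝ] (ℝ × ℝ))| : ℝ) * C, ?_, fun P Q hP hQ => ?_⟩
  · exact mul_ne_zero (by simpa using hdet) hC
  · have := tensor_apply_of_eq_mul μ (conjDist ν)
      (SchwartzMap.compCLMOfContinuousLinearEquiv ℂ T.symm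
        (partialFourier (lineTest hD P Q hP hQ))) (𝓕 P) (𝓕 Q) C fun x y => by
        rw [← h P Q hP hQ, ← hT]
        rfl
    rw [mul_assoc, TemperedDistribution.fourier_apply, TemperedDistribution.fourier_apply, ← this]
    rfl

/-- The Fourier transforms of the two factors of a matrix-Wigner transform which is a combination of
point masses on `A ×ˢ B` are tied along the lines `a q - b p = (a d - b c) s` with `s ∈ B`. -/
theorem lineRelation_of_hasSum (T : (ℝ × ℝ) ≃L[ℝ] (ℝ × ℝ)) {a b c d : ℝ}
    (hT : ∀ x y : ℝ, T.symm (x, y) = (a * x + b * y, c * x + d * y)) (hD : a * d - b * c ≠ 0)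
    (μ ν : 𝓢'(ℝ, ℂ)) (A B : Set ℝ) (coef : ℝ × ℝ → ℂ)
    (hW : HasSum (fun p : ↥(A ×ˢ B) => coef (p : ℝ × ℝ) • (delta (p : ℝ × ℝ) : 𝓢'(ℝ × ℝ, ℂ)))
      (matrixWigner T μ ν)) :
    LineRelation B (a / (a * d - b * c)) (-b / (a * d - b * c)) (𝓕 μ) (𝓕 (conjDist ν)) := by
  intro P Q hP hQ s₀ hs₀
  obtain ⟨C, hC, h⟩ := exists_matrixWigner_lineTest T hT hD μ ν
  set D := a * d - b * c with hDdef
  have hP' : HasCompactSupport (mulId P) :=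
    hP.isCompact.of_isClosed_subset (isClosed_tsupport _) (tsupport_mulId_subset P)
  have hQ' : HasCompactSupport (mulId Q) :=
    hQ.isCompact.of_isClosed_subset (isClosed_tsupport _) (tsupport_mulId_subset Q)
  have hDC : (D : ℂ) ≠ 0 := by exact_mod_cast hD
  have hint : ∀ (P Q : 𝓢(ℝ, ℂ)) (r s : ℝ), HasCompactSupport P → HasCompactSupport Q →
      Integrable fun x : ℝ => P (a * x + c * s) * Q (b * x + d * s) *
        Complex.exp (-(2 * Real.pi * Complex.I) * r * x) := fun P Q r s hP hQ =>
    integrable_pf (SchwartzMap.compCLMOfContinuousLinearEquiv ℂ (coordChange a b c d hD)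
      ((hasCompactSupport_mul_prod hP hQ).toSchwartzMap
        (((P.smooth ⊤).comp contDiff_fst).mul ((Q.smooth ⊤).comp contDiff_snd)))) (s, r)
  set φ : 𝓢(ℝ × ℝ, ℂ) := ((-b / D : ℝ) : ℂ) • lineTest hD (mulId P) Q hP' hQ +
    ((a / D : ℝ) : ℂ) • lineTest hD P (mulId Q) hP hQ' - (s₀ : ℂ) • lineTest hD P Q hP hQ with hφ
  -- On the line with parameter `s`, the weight `(a q - b p) / D - s₀` is the constant `s - s₀`. For
  -- `s ∈ B`, either the line misses the supports of `P` and `Q`, or the hypothesis forces `s = s₀`.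
  have hφ0 : ∀ (r : ℝ), ∀ s ∈ B, φ (r, s) = 0 := by
    intro r s hs
    have e : φ (r, s) = ∫ x : ℝ, ((s : ℂ) - s₀) * (P (a * x + c * s) * Q (b * x + d * s) *
        Complex.exp (-(2 * Real.pi * Complex.I) * r * x)) := by
      rw [hφ, sub_apply, add_apply, smul_apply, smul_apply, smul_apply, lineTest_apply,
        lineTest_apply, lineTest_apply, smul_eq_mul, smul_eq_mul, smul_eq_mul,
        ← integral_const_mul, ← integral_const_mul, ← integral_const_mul,
        ← integral_add ((hint _ _ r s hP' hQ).const_mul _) ((hint _ _ r s hP hQ').const_mul _),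
        ← integral_sub ?_ ((hint _ _ r s hP hQ).const_mul _)]
      swap
      · exact ((hint _ _ r s hP' hQ).const_mul _).add ((hint _ _ r s hP hQ').const_mul _)
      congr 1
      ext x
      simp only [mulId_apply]
      push_cast
      have hD2 : (D : ℂ) = a * d - b * c := by rw [hDdef]; push_cast; ring
      field_simp
      rw [hD2]
      ring
    rw [e]
    refine (integral_congr_ae (Filter.Eventually.of_forall fun x => ?_)).trans (integral_zero ℝ ℂ)
    change ((s : ℂ) - s₀) * (P (a * x + c * s) * Q (b * x + d * s) * _) = 0
    by_cases h1 : a * x + c * s ∈ tsupport P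
    · by_cases h2 : b * x + d * s ∈ tsupport Q
      · have e3 : -b / D * (a * x + c * s) + a / D * (b * x + d * s) = s := by
          field_simp
          rw [hDdef]
          ring
        have := hs₀ _ h1 _ h2 (by rw [e3]; exact hs)
        rw [e3] at this
        rw [this, sub_self, zero_mul]
      · rw [image_eq_zero_of_notMem_tsupport h2]
        simp
    · rw [image_eq_zero_of_notMem_tsupport h1]
      simp
  -- Evaluation at `φ` is continuous for pointwise convergence, so the series can be tested term by
  -- term; every term vanishes.
  have hsum := hW.map (PointwiseConvergenceCLM.evalCLM (RingHom.id ℂ) ℂ φ)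
    (PointwiseConvergenceCLM.evalCLM (RingHom.id ℂ) ℂ φ).continuous
  have hzero : matrixWigner T μ ν φ = 0 := by
    refine hsum.unique ?_
    convert! hasSum_zero using 1
    ext p
    change coef p * φ (p : ℝ × ℝ) = 0
    rw [hφ0 (p : ℝ × ℝ).1 (p : ℝ × ℝ).2 p.2.2, mul_zero]
  rw [hφ, map_sub, map_add, map_smul, map_smul, map_smul, h, h, h, smul_eq_mul, smul_eq_mul,
    smul_eq_mul] at hzero
  refine mul_left_cancel₀ hC ?_
  linear_combination hzero

/-! ### Nonvanishing of the factors, and the passage from `conj ν` to `ν`. -/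

theorem conjDist_ne_zero {ν : 𝓢'(ℝ, ℂ)} (hν : ν ≠ 0) : conjDist ν ≠ 0 := by
  intro h
  refine hν (DFunLike.ext _ _ fun φ => ?_)
  have h1 : conjDist ν (conjSchwartz φ) = 0 := by rw [h]; rfl
  have h2 : conjSchwartz (conjSchwartz φ) = φ := by
    ext x
    simp
  rw [conjDist_apply, h2] at h1
  simpa using h1

theorem fourier_ne_zero {ν : 𝓢'(ℝ, ℂ)} (hν : ν ≠ 0) : 𝓕 ν ≠ 0 := by
  intro h
  refine hν ?_
  rw [← FourierTransform.fourierInv_fourier_eq (F := 𝓢'(ℝ, ℂ)) ν, h]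
  exact map_zero (FourierTransform.fourierInvCLM ℂ 𝓢'(ℝ, ℂ))

/-- Conjugating a distribution conjugates and reflects its Fourier transform, so the atoms move from
`S` to `-S`. On test functions this is the identity `conj (𝓕 R) = 𝓕 P` for `R x = conj (P (-x))`. -/
theorem IsDiracComb.of_fourier_conjDist {ν : 𝓢'(ℝ, ℂ)} (h : IsDiracComb (𝓕 (conjDist ν))) :
    IsDiracComb (𝓕 ν) := by
  obtain ⟨S, ⟨δ, hδ, hS⟩, h⟩ := h
  refine ⟨{p | -p ∈ S}, ⟨δ, hδ, fun r hr s hs hne => ?_⟩, fun P hP hP0 => ?_⟩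
  · have := hS _ hr _ hs fun e => hne (neg_injective e)
    rwa [neg_sub_neg, abs_sub_comm] at this
  · set R : 𝓢(ℝ, ℂ) := conjSchwartz (SchwartzMap.compCLMOfContinuousLinearEquiv ℂ
      (ContinuousLinearEquiv.neg ℝ) P) with hR
    have hRa : ∀ x, R x = conj (P (-x)) := fun x => rfl
    have hRc : HasCompactSupport R := by
      have h1 : HasCompactSupport fun x => P (-x) := hP.comp_homeomorph (Homeomorph.neg ℝ)
      exact h1.comp_left (g := conj) (map_zero _)
    have h0 := h R hRc fun p hp => by
      rw [hRa, hP0 (-p) (by simpa using hp), map_zero]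
    have e : conjSchwartz (𝓕 R) = 𝓕 P := by
      ext ξ
      rw [conjSchwartz_apply, fourier_apply_eq_integral, fourier_apply_eq_integral,
        ← integral_conj, ← integral_neg_eq_self]
      congr 1
      ext x
      rw [hRa, map_mul, neg_neg, Complex.conj_conj, ← Complex.exp_conj]
      congr 2
      simp only [map_mul, map_neg, Complex.conj_ofReal, Complex.conj_I, Complex.ofReal_neg,
        Complex.conj_ofNat]
      ring
    rw [TemperedDistribution.fourier_apply, conjDist_apply, e] at h0
    rw [TemperedDistribution.fourier_apply]
    simpa using h0

end MatrixWigner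

theorem mainTheorem8
    (T : (ℝ × ℝ) ≃L[ℝ] (ℝ × ℝ)) (a b c d : ℝ)
    (hT : ∀ x y : ℝ, T.symm (x, y) = (a * x + b * y, c * x + d * y)) (hab : a * b ≠ 0)
    (μ ν : 𝓢'(ℝ, ℂ)) (hμ : μ ≠ 0) (hν : ν ≠ 0)
    (A B : Set ℝ) (hA : MatrixWigner.UniformlyDiscrete A) (hB : MatrixWigner.UniformlyDiscrete B)
    (coef : ℝ × ℝ → ℂ)
    (hW : HasSum (fun p : ↥(A ×ˢ B) => coef (p : ℝ × ℝ) • (delta (p : ℝ × ℝ) : 𝓢'(ℝ × ℝ, ℂ)))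
      (MatrixWigner.matrixWigner T μ ν)) :
    (MatrixWigner.IsMeasure (𝓕 μ) ∧
      ∃ S : Set ℝ, MatrixWigner.UniformlyDiscrete S ∧ Distribution.dsupport (𝓕 μ : 𝓢'(ℝ, ℂ)) ⊆ S) ∧
    (MatrixWigner.IsMeasure (𝓕 ν) ∧
      ∃ S : Set ℝ, MatrixWigner.UniformlyDiscrete S ∧
        Distribution.dsupport (𝓕 ν : 𝓢'(ℝ, ℂ)) ⊆ S) := by
  have ha : a ≠ 0 := left_ne_zero_of_mul hab
  have hb : b ≠ 0 := right_ne_zero_of_mul hab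
  have hD : a * d - b * c ≠ 0 := by
    intro h0
    -- If the determinant vanished, `(b, -a)` would be a nonzero kernel vector of `T⁻¹`.
    have h1 : T.symm (b, -a) = 0 := by
      rw [hT]
      ext
      · simp
        ring
      · simp
        linarith
    have h2 : ((b, -a) : ℝ × ℝ) = 0 := T.symm.map_eq_zero_iff.1 h1
    exact hb (congrArg Prod.fst h2)
  have hrel := MatrixWigner.lineRelation_of_hasSum T hT hD μ ν A B coef hW
  have hμ' : MatrixWigner.IsDiracComb (𝓕 μ) :=
    hrel.isDiracComb hB (div_ne_zero (neg_ne_zero.2 hb) hD)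
      (MatrixWigner.fourier_ne_zero (MatrixWigner.conjDist_ne_zero hν))
  have hν' : MatrixWigner.IsDiracComb (𝓕 ν) :=
    (hrel.symm.isDiracComb hB (div_ne_zero ha hD)
      (MatrixWigner.fourier_ne_zero hμ)).of_fourier_conjDist
  exact ⟨⟨hμ'.isMeasure, hμ'.exists_dsupport_subset⟩, hν'.isMeasure, hν'.exists_dsupport_subset⟩
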